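/- Let $\mathcal A,\mathcal B$ be nonempty compact metric spaces, let $f:\mathbb R^n\times\mathcal A\times\mathcal B\to\mathbb R^n$ be bounded and Lipschitz continuous, let $c:\mathbb R^n\times\mathcal A\times\mathcal B\to\mathbb R$ be continuous with $\min_{s,a,b}c(s,a,b)=\gamma>0$, let $K\subseteq\mathbb R^n$ be closed, and let $\bar T\ge 0$. Put $\hat f(s,a,b)=f(s,a,b)$ and $\hat c(s,a,b)=c(s,a,b)$ for $s\notin K$, and $\hat f(s,a,b)=0$, $\hat c(s,a,b)=0$ for $s\in K$. Let $\mathscr A_t,\mathscr B_t$ be the sets of Lebesgue measurable functions from $[t,\infty)$ to $\mathcal A$ and $\mathcal B$, and let $\mathfrak B_t$ be the set of nonanticipative strategies of Player II, that is, of maps $\beta:\mathscr A_t\to\mathscr B_t$ such that for all $r\ge t$ and $a,a'\in\mathscr A_t$, if $a=a'$ a.e. on $[t,r]$ then $\beta[a]=\beta[a']$ a.e. on $[t,r]$. For $a\in\mathscr A_t$, $b\in\mathscr B_t$ let $\hat\phi^{a,b}_{s,t}:[t,\infty)\to\mathbb R^n$ be the continuous solution of $\hat\phi(\tau)=s+\int_t^\tau\hat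 f(\hat\phi(r),a(r),b(r))\,dr$ that remains constant from the first time at which it is in $K$ (if there is such a time). For $s\in\mathbb R^n$, $t\in[0,\bar T]$ let $$W^c_{\bar T}(s,t)=\sup_{\beta\in\mathfrak B_t}\ \inf_{a\in\mathscr A_t}\int_t^{\bar T}\hat c\big(\hat\phi^{a,\beta[a]}_{s,t}(r),a(r),\beta[a](r)\big)\,dr .$$ Then $W=W^c_{\bar T}$ is finite and locally bounded, and it is a (possibly discontinuous) viscosity solution of $$\frac{\partial W}{\partial t}(s,t)+H\Big(s,\frac{\partial W}{\partial s}(s,t)\Big)=0\ \text{ on }\mathbb R^n\times(0,\bar T),\qquad W(s,\bar T)=0,\qquad H(s,p)=\min_{a\in\mathcal A}\max_{b\in\mathcal B}\big\{\hat c(s,a,b)+p\cdot\hat f(s,a,b)\big\},$$ in the following sense. Denote by $W^*,H^*$ the upper and by $W_*,H_*$ the lower semicontinuous envelopes of $W$ (on $\mathbb R^n\times[0,\bar T]$) and of $H$ (in $(s,p)$). For every $\varphi\in C^1(\mathbb R^n\times(0,\bar T))$ and every $(s_0,t_0)\in\mathbb R^n\times(0,\bar T)$: 1. if $W^*-\varphi$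 has a local maximum at $(s_0,t_0)$, then $\partial_t\varphi+H^*(s_0,\partial_s\varphi)\ge 0$ at $(s_0,t_0)$; 2. if $W_*-\varphi$ has a local minimum at $(s_0,t_0)$, then $\partial_t\varphi+H_*(s_0,\partial_s\varphi)\le 0$ at $(s_0,t_0)$; 3. the same two implications hold with $W$ in place of $W^*,W_*$ and $H$ in place of $H^*,H_*$. Moreover $W(s,\bar T)=W^*(s,\bar T)=W_*(s,\bar T)=0$ for every $s\in\mathbb R^n$. -/

import Mathlib

open MeasureTheory Filter Topology

noncomputable section

/-! ## The differential game -/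

/-- Lebesgue measurable control inputs on `[t, ∞)` with values in `A`.  Functions are written on all
of `ℝ`; only their restriction to `[t, ∞)` matters. (For a compact metric space `A`, Lebesgue
measurability is the same as being almost everywhere equal to a Borel function.) -/
def Control (A : Type*) [MeasurableSpace A] (t : ℝ) : Type _ :=
  {a : ℝ → A // AEMeasurable a (volume.restrict (Set.Ici t))}

/-- Nonanticipative strategies of Player II from time `t` on. -/
def Strategy (A B : Type*) [MeasurableSpace A] [MeasurableSpace B] (t : ℝ) : Type _ :=
  {β : Control A t → Control B t //
    ∀ r ∈ Set.Ici t, ∀ a a' : Control A t,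
      (∀ᵐ τ ∂(volume.restrict (Set.Icc t r)), a.1 τ = a'.1 τ) →
        ∀ᵐ τ ∂(volume.restrict (Set.Icc t r)), (β a).1 τ = (β a').1 τ}

variable {A B : Type*} {E : Type*}

open Classical in
/-- The modification `ĝ` of a function `g` of state and controls: equal to `g` off `K`, zero on `K`.
It is used both for the dynamics (frozen on `K`) and for the running cost (free on `K`). -/
def zeroOn {F : Type*} [Zero F] (K : Set E) (g : E → A → B → F) (s : E) (a : A) (b : B) : F :=
  if s ∈ K then 0 else g s a b

variable [NormedAddCommGroup E] [NormedSpace ℝ E]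

/-- `x` is the trajectory on `[t, ∞)` of the modified system `ẋ = f̂(x, a, b)`, `x(t) = s`
(in integrated form, the controls being merely measurable).  Since `f̂` is discontinuous on the
boundary of `K`, the differential equation for almost every time does not by itself prevent a
trajectory from leaving `K`; the last field says that a trajectory that has reached `K` stays at
the point where it is. -/
structure IsModifiedTrajectory (f : E → A → B → E) (K : Set E) (s : E) (t : ℝ)
    (a : ℝ → A) (b : ℝ → B) (x : ℝ → E) : Prop where
  continuousOn : ContinuousOn x (Set.Ici t)
  integral_eq : ∀ τ ∈ Set.Ici t, x τ = s + ∫ r in t..τ, zeroOn K f (x r) (a r) (b r)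
  frozen : ∀ τ ∈ Set.Ici t, x τ ∈ K → ∀ τ' ∈ Set.Ici τ, x τ' = x τ

/-- The truncated value function
`W(s, t) = sup_β inf_a ∫_t^T ĉ(x(r), a(r), β[a](r)) dr`, where `x` is the trajectory of the modified
system from `(s, t)` under `a` and `β[a]`.  It is extended-real-valued, so that the supremum and the
infimum always have their order-theoretic meaning. -/
def truncatedValue [MeasurableSpace A] [MeasurableSpace B] (f : E → A → B → E)
    (c : E → A → B → ℝ) (K : Set E) (T : ℝ) (z : E × ℝ) : EReal :=
  ⨆ β : Strategy A B z.2, ⨅ a : Control A z.2, ⨅ x : ℝ → E,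
    ⨅ _ : IsModifiedTrajectory f K z.1 z.2 a.1 (β.1 a).1 x,
      ((∫ r in z.2..T, zeroOn K c (x r) (a.1 r) ((β.1 a).1 r) : ℝ) : EReal)

/-- The Hamiltonian `H(s, p) = min_a max_b {ĉ(s, a, b) + p · f̂(s, a, b)}`, the covector `p` being a
linear functional.  (The extrema are attained for compact control sets and continuous data.) -/
def hamiltonian (f : E → A → B → E) (c : E → A → B → ℝ) (K : Set E) (s : E) (p : E →L[ℝ] ℝ) : ℝ :=
  ⨅ a : A, ⨆ b : B, (zeroOn K c s a b + p (zeroOn K f s a b))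

/-! ## Viscosity solutions of `∂ₜ u + H(s, ∂ₛ u) = 0`, `u(s, T) = g(s)` -/

/-- Upper semicontinuous envelope, at `z`, of a function on `D`. -/
def upperEnvelope {X : Type*} [TopologicalSpace X] (D : Set X) (u : X → EReal) (z : X) : EReal :=
  limsup u (𝓝[D] z)

/-- Lower semicontinuous envelope, at `z`, of a function on `D`. -/
def lowerEnvelope {X : Type*} [TopologicalSpace X] (D : Set X) (u : X → EReal) (z : X) : EReal :=
  liminf u (𝓝[D] z)

/-- The closed strip `E × [0, T]`. -/
def strip (E : Type*) (T : ℝ) : Set (E × ℝ) := Set.univ ×ˢ Set.Icc 0 T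

/-- The open strip `E × (0, T)`. -/
def openStrip (E : Type*) (T : ℝ) : Set (E × ℝ) := Set.univ ×ˢ Set.Ioo 0 T

/-- Test-function inequality from above: whenever a `C¹` function `φ` touches `u` from above at
`(s₀, t₀)`, then `∂ₜφ + G(s₀, ∂ₛφ) ≥ 0` at `(s₀, t₀)`.  (This is the inequality for subsolutions of
a terminal-value problem.) -/
def SubsolutionTest (T : ℝ) (G : E → (E →L[ℝ] ℝ) → EReal) (u : E × ℝ → EReal) : Prop :=
  ∀ φ : E × ℝ → ℝ, ContDiffOn ℝ 1 φ (openStrip E T) → ∀ z₀ ∈ openStrip E T,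
    u z₀ = (φ z₀ : EReal) → (∀ᶠ z in 𝓝 z₀, u z ≤ (φ z : EReal)) →
      0 ≤ ((fderiv ℝ φ z₀ (0, 1) : ℝ) : EReal) +
        G z₀.1 ((fderiv ℝ φ z₀).comp (ContinuousLinearMap.inl ℝ E ℝ))

/-- Test-function inequality from below: whenever a `C¹` function `φ` touches `u` from below at
`(s₀, t₀)`, then `∂ₜφ + G(s₀, ∂ₛφ) ≤ 0` at `(s₀, t₀)`. -/
def SupersolutionTest (T : ℝ) (G : E → (E →L[ℝ] ℝ) → EReal) (u : E × ℝ → EReal) : Prop :=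
  ∀ φ : E × ℝ → ℝ, ContDiffOn ℝ 1 φ (openStrip E T) → ∀ z₀ ∈ openStrip E T,
    u z₀ = (φ z₀ : EReal) → (∀ᶠ z in 𝓝 z₀, (φ z : EReal) ≤ u z) →
      ((fderiv ℝ φ z₀ (0, 1) : ℝ) : EReal) +
        G z₀.1 ((fderiv ℝ φ z₀).comp (ContinuousLinearMap.inl ℝ E ℝ)) ≤ 0

/-- `u` is a (possibly discontinuous) viscosity solution on `E × [0, T]` of
`∂ₜ u + H(s, ∂ₛ u) = 0`, `u(s, T) = g(s)`, with a possibly discontinuous Hamiltonian `H`.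

The fields `subsolution` and `supersolution` are the definition of Ishii, in which the envelopes of
`u` and of `H` are used; the fields `subsolution_pointwise` and `supersolution_pointwise` are the
inequalities of Crandall, Evans and Lions for `u` and `H` themselves. For continuous `H` the latter
follow from the former, and for continuous `u` and `H` the two pairs are the same. -/
structure IsViscositySolution (T : ℝ) (H : E → (E →L[ℝ] ℝ) → ℝ) (g : E → ℝ)
    (u : E × ℝ → EReal) : Prop where
  /-- `u` is finite and locally bounded -/
  locally_bounded : ∀ z ∈ strip E T,
    upperEnvelope (strip E T) u z < ⊤ ∧ ⊥ < lowerEnvelope (strip E T) u z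
  subsolution : SubsolutionTest T
    (fun s p => upperEnvelope Set.univ (fun q : E × (E →L[ℝ] ℝ) => (H q.1 q.2 : EReal)) (s, p))
    (upperEnvelope (strip E T) u)
  supersolution : SupersolutionTest T
    (fun s p => lowerEnvelope Set.univ (fun q : E × (E →L[ℝ] ℝ) => (H q.1 q.2 : EReal)) (s, p))
    (lowerEnvelope (strip E T) u)
  subsolution_pointwise : SubsolutionTest T (fun s p => (H s p : EReal)) u
  supersolution_pointwise : SupersolutionTest T (fun s p => (H s p : EReal)) u
  /-- the terminal condition -/
  terminal : ∀ s, u (s, T) = (g s : EReal)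
  /-- the terminal value is attained continuously -/
  terminal_envelopes : ∀ s, upperEnvelope (strip E T) u (s, T) = (g s : EReal) ∧
    lowerEnvelope (strip E T) u (s, T) = (g s : EReal)

end

/-! ### Carathéodory equations: Grönwall's lemma and global existence. -/

section Caratheodory

/-! The proof is a quantitative dynamic programming argument that never uses continuity of the value
`W`. Suppose `φ` lies above `W` near `z₀` and the test inequality fails there. Then some constant
action of the minimizer makes `φ` plus running cost decrease at a rate at least `θ > 0`, at every
state near `z₀` and against every response. Playing it for a short time `h`, then continuing almost
optimally, gives `W ≤ φ - θh/2` on a whole neighbourhood of `z₀` (`truncatedValue_le_sub`). This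
contradicts contact at `z₀` of `φ` with `W` and with its upper envelope alike. From below, the
maximizer answers the opponent's current action through a measurable map `ψ : A → B`, and then uses
a strategy chosen according to the point reached (`add_le_truncatedValue`).

The jump of the dynamics at the boundary of `K` is absorbed by the envelopes of `H`. At a boundary
point `H^*` dominates both `0` and the unmodified Hamiltonian, and `H_*` is below both. Failure of
an envelope inequality therefore gives a strict rate in `K` and off `K` simultaneously, with the
same action or feedback (`exists_action_zeroOn`, `exists_feedback_zeroOn`). The pointwise
inequalities need no envelope. Off the closed set `K` the data are locally unmodified, while at a
point of `K` both `W(s₀, ·)` and `H` vanish, so that `φ(s₀, ·)` has a local extremum and `∂ₜφ = 0`.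

The terminal statements follow from `0 ≤ W ≤ C(T - t)`, valid locally. -/

theorem intervalIntegrable_of_bounded {E : Type*} [NormedAddCommGroup E] {g : ℝ → E} {t τ C : ℝ}
    (hg : AEStronglyMeasurable g (volume.restrict (Set.Ici t))) (htτ : t ≤ τ)
    (hC : ∀ r ∈ Set.Ioc t τ, ‖g r‖ ≤ C) : IntervalIntegrable g volume t τ := by
  rw [intervalIntegrable_iff_integrableOn_Ioc_of_le htτ]
  have hg' : AEStronglyMeasurable g (volume.restrict (Set.Ioc t τ)) :=
    hg.mono_measure (Measure.restrict_mono (fun r hr => hr.1.le) le_rfl)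
  refine ⟨hg', HasFiniteIntegral.restrict_of_bounded C measure_Ioc_lt_top ?_⟩
  filter_upwards [ae_restrict_mem measurableSet_Ioc] with r hr using hC r hr

theorem integral_exp_mul_sub_le {k : ℝ} (hk : 0 < k) (t τ : ℝ) :
    ∫ r in t..τ, Real.exp (k * (r - t)) ≤ Real.exp (k * (τ - t)) / k := by
  have h : ∀ r ∈ Set.uIcc t τ, HasDerivAt (fun r => Real.exp (k * (r - t)) / k)
      (Real.exp (k * (r - t))) r := by
    intro r _
    have h1 : HasDerivAt (fun r => k * (r - t)) k r := by
      simpa using ((hasDerivAt_id r).sub_const t).const_mul k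
    have h2 := h1.exp.div_const k
    rwa [mul_div_cancel_right₀ _ hk.ne'] at h2
  rw [intervalIntegral.integral_eq_sub_of_hasDerivAt h
    (Continuous.intervalIntegrable (by fun_prop) _ _)]
  have : 0 < Real.exp (k * (t - t)) / k := by positivity
  linarith

/-- Integral form of Grönwall's lemma with zero initial value. -/
theorem eq_zero_of_le_integral {d : ℝ → ℝ} {t σ L : ℝ} (hL : 0 ≤ L)
    (hd : ContinuousOn d (Set.Icc t σ)) (hd0 : ∀ τ ∈ Set.Icc t σ, 0 ≤ d τ)
    (h : ∀ τ ∈ Set.Icc t σ, d τ ≤ L * ∫ r in t..τ, d r) : ∀ τ ∈ Set.Icc t σ, d τ = 0 := by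
  intro τ₀ hτ₀
  have htσ : t ≤ σ := hτ₀.1.trans hτ₀.2
  -- With the weight `exp (-k(τ - t))`, the weighted maximum `m` satisfies `m ≤ (L/k) m`, and `L/k <
  -- 1/2` forces `m = 0`.
  set k : ℝ := 2 * L + 1
  have hk : 0 < k := by positivity
  obtain ⟨τm, hτm, hmax⟩ := isCompact_Icc.exists_isMaxOn (Set.nonempty_Icc.2 htσ)
    (f := fun τ => Real.exp (-(k * (τ - t))) * d τ) (by fun_prop)
  set m := Real.exp (-(k * (τm - t))) * d τm with hm
  have hbd : ∀ r ∈ Set.Icc t σ, d r ≤ m * Real.exp (k * (r - t)) := by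
    intro r hr
    have h1 : Real.exp (-(k * (r - t))) * d r ≤ m := hmax hr
    calc d r = Real.exp (-(k * (r - t))) * d r * Real.exp (k * (r - t)) := by
          rw [mul_right_comm, ← Real.exp_add]; simp
      _ ≤ _ := by gcongr
  have hm0 : 0 ≤ m := mul_nonneg (Real.exp_pos _).le (hd0 _ hτm)
  have hint : ∫ r in t..τm, d r ≤ m * (Real.exp (k * (τm - t)) / k) := by
    calc ∫ r in t..τm, d r ≤ ∫ r in t..τm, m * Real.exp (k * (r - t)) := by
          refine intervalIntegral.integral_mono_on hτm.1 ?_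
            (Continuous.intervalIntegrable (by fun_prop) _ _) ?_
          · refine ContinuousOn.intervalIntegrable_of_Icc hτm.1 (hd.mono ?_)
            exact Set.Icc_subset_Icc_right hτm.2
          · exact fun r hr => hbd r ⟨hr.1, hr.2.trans hτm.2⟩
      _ ≤ _ := by
          rw [intervalIntegral.integral_const_mul]
          gcongr
          exact integral_exp_mul_sub_le hk _ _
  have h3 : m ≤ L * (m / k) := by
    have h4 := (h _ hτm).trans (mul_le_mul_of_nonneg_left hint hL)
    calc m ≤ Real.exp (-(k * (τm - t))) * (L * (m * (Real.exp (k * (τm - t)) / k))) := by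
          rw [hm]; gcongr
      _ = L * (m / k) * (Real.exp (-(k * (τm - t))) * Real.exp (k * (τm - t))) := by ring
      _ = _ := by rw [← Real.exp_add]; simp
  have hm1 : m = 0 := by
    rw [mul_div_assoc', le_div_iff₀ hk] at h3
    nlinarith
  have := hbd τ₀ hτ₀
  rw [hm1, zero_mul] at this
  exact le_antisymm this (hd0 _ hτ₀)

/-- Global solvability of a Carathéodory differential equation with bounded right-hand side that is
Lipschitz continuous in the state. -/
theorem exists_integral_solution {E : Type*} [NormedAddCommGroup E] [NormedSpace ℝ E]
    [CompleteSpace E] {G : ℝ → E → E} {t M L : ℝ} (hL : 0 ≤ L)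
    (hGm : ∀ x : ℝ → E, Continuous x →
      AEStronglyMeasurable (fun r => G r (x r)) (volume.restrict (Set.Ici t)))
    (hGb : ∀ r x, ‖G r x‖ ≤ M) (hGL : ∀ r x y, ‖G r x - G r y‖ ≤ L * ‖x - y‖) (s : E) :
    ∃ y : ℝ → E, Continuous y ∧ ∀ τ ∈ Set.Ici t, y τ = s + ∫ r in t..τ, G r (y r) := by
  have hM : 0 ≤ M := (norm_nonneg _).trans (hGb 0 0)
  -- `L/k ≤ 1/2` gives the contraction; `k ≥ 1` gives `u ≤ exp (k u)`, which keeps the weighted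
  -- integral bounded by `M`.
  set k : ℝ := 2 * L + 1
  have hk : 0 < k := by positivity
  have hk1 : 1 ≤ k := by simp only [k]; linarith
  -- The unknown is `z = exp (-k(r - t)) (y - s)`, so the plain sup norm of `z` is an exponentially
  -- weighted norm of `y - s`, and one contraction solves the equation on the whole half-line.
  let X : BoundedContinuousFunction ℝ E → ℝ → E :=
    fun z r => s + Real.exp (k * (r - t)) • z r
  have hX : ∀ z, Continuous (X z) := fun z => by
    have := z.continuous
    fun_prop
  have hint : ∀ z τ, t ≤ τ → IntervalIntegrable (fun r => G r (X z r)) volume t τ :=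
    fun z τ hτ => intervalIntegrable_of_bounded (hGm _ (hX z)) hτ fun r _ => hGb r _
  -- The truncation `max τ t` extends the integral constantly to times before `t`, where nothing is
  -- known about the measurability of `G`.
  let I : BoundedContinuousFunction ℝ E → ℝ → E :=
    fun z τ => ∫ r in t..(max τ t), G r (X z r)
  have hIc : ∀ z, Continuous (I z) := by
    intro z
    have h1 : LipschitzWith ⟨M, hM⟩ (I z) := by
      refine LipschitzWith.of_dist_le_mul fun τ τ' => ?_
      rw [dist_eq_norm]
      simp only [I]
      rw [intervalIntegral.integral_interval_sub_left (hint z _ (le_max_right _ _))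
        (hint z _ (le_max_right _ _))]
      refine (intervalIntegral.norm_integral_le_of_norm_le_const fun r _ => hGb r _).trans ?_
      change M * _ ≤ M * _
      gcongr
      exact (abs_max_sub_max_le_abs τ τ' t)
    exact h1.continuous
  let Φ : BoundedContinuousFunction ℝ E → BoundedContinuousFunction ℝ E := fun z =>
    BoundedContinuousFunction.ofNormedAddCommGroup
      (fun τ => Real.exp (-(k * (max τ t - t))) • I z τ)
      (by have := hIc z; fun_prop) M (by
        intro τ
        have hu : 0 ≤ max τ t - t := sub_nonneg.2 (le_max_right _ _)
        set u := max τ t - t with hu'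
        have h1 : ‖I z τ‖ ≤ M * u := by
          refine (intervalIntegral.norm_integral_le_of_norm_le_const fun r _ => hGb r _).trans ?_
          rw [← hu', abs_of_nonneg hu]
        rw [norm_smul, Real.norm_eq_abs, Real.abs_exp]
        have h2 : u ≤ Real.exp (k * u) := by
          have := Real.add_one_le_exp (k * u)
          nlinarith
        calc Real.exp (-(k * u)) * ‖I z τ‖ ≤ Real.exp (-(k * u)) * (M * Real.exp (k * u)) := by
              gcongr; exact h1.trans (by gcongr)
          _ = M * (Real.exp (-(k * u)) * Real.exp (k * u)) := by ring
          _ = M := by rw [← Real.exp_add]; simp)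
  have hΦ : ContractingWith (1 / 2) Φ := by
    refine ⟨by norm_num, LipschitzWith.of_dist_le_mul fun z z' => ?_⟩
    rw [BoundedContinuousFunction.dist_le (by positivity)]
    intro τ
    have hτ : t ≤ max τ t := le_max_right _ _
    have h1 : ‖I z τ - I z' τ‖ ≤ L * dist z z' * (Real.exp (k * (max τ t - t)) / k) := by
      simp only [I]
      rw [← intervalIntegral.integral_sub (hint z _ hτ) (hint z' _ hτ)]
      refine (intervalIntegral.norm_integral_le_of_norm_le hτ
        (g := fun r => L * dist z z' * Real.exp (k * (r - t))) (ae_of_all _ fun r _ => ?_)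
        (Continuous.intervalIntegrable (by fun_prop) _ _)).trans ?_
      · refine (hGL _ _ _).trans ?_
        have h2 : X z r - X z' r = Real.exp (k * (r - t)) • (z r - z' r) := by
          simp only [X, smul_sub]; abel
        rw [h2, norm_smul, Real.norm_eq_abs, Real.abs_exp, ← dist_eq_norm]
        have := BoundedContinuousFunction.dist_coe_le_dist (f := z) (g := z') r
        calc L * (Real.exp (k * (r - t)) * dist (z r) (z' r))
            ≤ L * (Real.exp (k * (r - t)) * dist z z') := by gcongr
          _ = _ := by ring
      · rw [intervalIntegral.integral_const_mul]
        gcongr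
        exact integral_exp_mul_sub_le hk _ _
    have h3 : dist (Φ z τ) (Φ z' τ)
        = Real.exp (-(k * (max τ t - t))) * ‖I z τ - I z' τ‖ := by
      rw [dist_eq_norm]
      simp only [Φ, BoundedContinuousFunction.coe_ofNormedAddCommGroup]
      rw [← smul_sub, norm_smul, Real.norm_eq_abs, Real.abs_exp]
    rw [h3]
    calc Real.exp (-(k * (max τ t - t))) * ‖I z τ - I z' τ‖
        ≤ Real.exp (-(k * (max τ t - t))) *
          (L * dist z z' * (Real.exp (k * (max τ t - t)) / k)) := by gcongr
      _ = L / k * dist z z' *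
          (Real.exp (-(k * (max τ t - t))) * Real.exp (k * (max τ t - t))) := by ring
      _ = L / k * dist z z' := by rw [← Real.exp_add]; simp
      _ ≤ 1 / 2 * dist z z' := by
          refine mul_le_mul_of_nonneg_right ?_ dist_nonneg
          rw [div_le_div_iff₀ hk (by norm_num)]
          simp only [k]; linarith
      _ = _ := by norm_num
  set z := hΦ.fixedPoint Φ
  have hz : Φ z = z := hΦ.fixedPoint_isFixedPt
  refine ⟨X z, hX z, fun τ hτ => ?_⟩
  have h1 : z τ = Real.exp (-(k * (max τ t - t))) • I z τ := by
    conv_lhs => rw [← hz]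
    rfl
  have hτ' : max τ t = τ := max_eq_left hτ
  change s + Real.exp (k * (τ - t)) • z τ = _
  rw [h1, smul_smul, hτ', ← Real.exp_add]
  simp [I, hτ']

end Caratheodory

section ZeroOn

variable {E A B F : Type*} {K : Set E}

theorem zeroOn_of_mem [Zero F] {g : E → A → B → F} {s : E} (h : s ∈ K) (a : A) (b : B) :
    zeroOn K g s a b = 0 := if_pos h

theorem zeroOn_of_notMem [Zero F] {g : E → A → B → F} {s : E} (h : s ∉ K) (a : A) (b : B) :
    zeroOn K g s a b = g s a b := if_neg h

theorem norm_zeroOn_le [NormedAddCommGroup F] (g : E → A → B → F) (s : E) (a : A) (b : B) :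
    ‖zeroOn K g s a b‖ ≤ ‖g s a b‖ := by
  unfold zeroOn; split_ifs <;> simp

end ZeroOn

/-! ### Concatenation of controls and almost everywhere agreement. -/

section Control

/-- The restriction of a control to a later half-line. -/
def Control.tail {A : Type*} [MeasurableSpace A] {t t₁ : ℝ} (h : t ≤ t₁) (a : Control A t) :
    Control A t₁ :=
  ⟨a.1, a.2.mono_measure (Measure.restrict_mono (Set.Ici_subset_Ici.2 h) le_rfl)⟩

/-- The control that follows `a` before time `t₁` and `a'` from `t₁` on. -/
noncomputable def Control.glue {A : Type*} [MeasurableSpace A] {t t₁ : ℝ} (a : Control A t)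
    (a' : Control A t₁) : Control A t :=
  ⟨fun r => if r < t₁ then a.1 r else a'.1 r,
    fun r => if r < t₁ then a.2.mk _ r else a'.2.mk _ r,
    Measurable.ite measurableSet_Iio a.2.measurable_mk a'.2.measurable_mk, by
      have h₁ := (ae_restrict_iff' measurableSet_Ici).1 a.2.ae_eq_mk
      have h₂ := (ae_restrict_iff' measurableSet_Ici).1 a'.2.ae_eq_mk
      refine (ae_restrict_iff' measurableSet_Ici).2 ?_
      filter_upwards [h₁, h₂] with r hr₁ hr₂ hr
      split_ifs with h
      · exact hr₁ hr
      · exact hr₂ (not_lt.1 h)⟩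

theorem Control.glue_of_lt {A : Type*} [MeasurableSpace A] {t t₁ : ℝ} (a : Control A t)
    (a' : Control A t₁) {r : ℝ} (h : r < t₁) : (a.glue a').1 r = a.1 r := if_pos h

theorem Control.glue_of_ge {A : Type*} [MeasurableSpace A] {t t₁ : ℝ} (a : Control A t)
    (a' : Control A t₁) {r : ℝ} (h : t₁ ≤ r) : (a.glue a').1 r = a'.1 r := if_neg (not_lt.2 h)

/-- A glued control already follows its second piece at `t₁`, whereas nonanticipativity is stated on
closed intervals; the endpoint is a null set. -/
theorem ae_restrict_Icc_of_lt {p : ℝ → Prop} {t t₁ : ℝ} (h : ∀ r, r < t₁ → p r) :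
    ∀ᵐ r ∂(volume.restrict (Set.Icc t t₁)), p r := by
  rw [← Measure.restrict_congr_set Ico_ae_eq_Icc]
  filter_upwards [ae_restrict_mem measurableSet_Ico] with r hr using h r hr.2

theorem ae_restrict_Icc_mono {p : ℝ → Prop} {t t₁ r₁ r : ℝ} (h₁ : t ≤ t₁) (h₂ : r₁ ≤ r)
    (h : ∀ᵐ τ ∂(volume.restrict (Set.Icc t r)), p τ) :
    ∀ᵐ τ ∂(volume.restrict (Set.Icc t₁ r₁)), p τ :=
  ae_restrict_of_ae_restrict_of_subset (Set.Icc_subset_Icc h₁ h₂) h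

theorem ae_uIoc_of_ae_restrict_Icc {p : ℝ → Prop} {t τ r : ℝ} (h₁ : t ≤ τ) (h₂ : τ ≤ r)
    (h : ∀ᵐ ρ ∂(volume.restrict (Set.Icc t r)), p ρ) : ∀ᵐ ρ, ρ ∈ Set.uIoc t τ → p ρ := by
  filter_upwards [(ae_restrict_iff' measurableSet_Icc).1 h] with ρ hρ hm
  rw [Set.uIoc_of_le h₁] at hm
  exact hρ ⟨hm.1.le, hm.2.trans h₂⟩

theorem ae_restrict_Icc_of_glue {p : ℝ → Prop} {t t₁ r : ℝ}
    (h₁ : ∀ᵐ τ ∂(volume.restrict (Set.Icc t t₁)), p τ)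
    (h₂ : ∀ᵐ τ ∂(volume.restrict (Set.Icc t₁ r)), p τ) :
    ∀ᵐ τ ∂(volume.restrict (Set.Icc t r)), p τ := by
  refine ae_restrict_of_ae_restrict_of_subset (t := Set.Icc t t₁ ∪ Set.Icc t₁ r) ?_
    ((ae_restrict_union_iff _ _ _).2 ⟨h₁, h₂⟩)
  intro τ hτ
  rcases le_total τ t₁ with h | h
  · exact Or.inl ⟨hτ.1, h⟩
  · exact Or.inr ⟨h, hτ.2⟩

end Control

section Basic

theorem LipschitzWith.norm_sub_le_of_snd_eq {E A B : Type*} [NormedAddCommGroup E]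
    [MetricSpace A] [MetricSpace B] {L : NNReal} {f : E → A → B → E}
    (hf : LipschitzWith L fun z : E × A × B => f z.1 z.2.1 z.2.2) (s s' : E) (a : A) (b : B) :
    ‖f s a b - f s' a b‖ ≤ L * ‖s - s'‖ := by
  have := hf.dist_le_mul (s, a, b) (s', a, b)
  simpa [dist_eq_norm, Prod.dist_eq] using this

variable {E A B : Type*} [NormedAddCommGroup E] [NormedSpace ℝ E] {K : Set E}
  {f : E → A → B → E}

theorem IsModifiedTrajectory.initial {t : ℝ} {s : E} {a : ℝ → A} {b : ℝ → B} {x : ℝ → E}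
    (hx : IsModifiedTrajectory f K s t a b x) : x t = s := by
  simpa using hx.integral_eq t Set.self_mem_Ici

theorem IsModifiedTrajectory.norm_sub_le {M : ℝ} (hM : ∀ s a b, ‖f s a b‖ ≤ M) {s : E} {t : ℝ}
    {a : ℝ → A} {b : ℝ → B} {x : ℝ → E}
    (hx : IsModifiedTrajectory f K s t a b x) {τ : ℝ} (h : t ≤ τ) :
    ‖x τ - s‖ ≤ M * (τ - t) := by
  rw [hx.integral_eq τ h, add_sub_cancel_left]
  refine (intervalIntegral.norm_integral_le_of_norm_le_const fun r _ =>
    (norm_zeroOn_le _ _ _ _).trans (hM _ _ _)).trans ?_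
  rw [abs_of_nonneg (sub_nonneg.2 h)]

theorem IsModifiedTrajectory.congr {s : E} {t : ℝ} {a a' : ℝ → A} {b b' : ℝ → B} {x : ℝ → E}
    (hx : IsModifiedTrajectory f K s t a b x) (ha : ∀ r, t ≤ r → a r = a' r)
    (hb : ∀ r, t ≤ r → b r = b' r) : IsModifiedTrajectory f K s t a' b' x where
  continuousOn := hx.continuousOn
  integral_eq τ hτ := by
    rw [hx.integral_eq τ hτ]
    congr 1
    refine intervalIntegral.integral_congr fun r hr => ?_
    rw [Set.uIcc_of_le hτ] at hr
    simp only [ha r hr.1, hb r hr.1]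
  frozen := hx.frozen

/-- In the sup norm of space-time the speed is at most `max M 1 ≤ M + 1`, so time `h` covers at most
`ρ / 2`. -/
theorem IsModifiedTrajectory.mem_ball {M : ℝ} (hM : ∀ s a b, ‖f s a b‖ ≤ M) (hM0 : 0 ≤ M)
    {z₀ : E × ℝ} {ρ h : ℝ} (hh : (M + 1) * h ≤ ρ / 2) {s : E} {t : ℝ}
    (hz : (s, t) ∈ Metric.ball z₀ (ρ / 2)) {a : ℝ → A} {b : ℝ → B} {x : ℝ → E}
    (hx : IsModifiedTrajectory f K s t a b x) {τ : ℝ} (hτ : τ ∈ Set.Icc t (t + h)) :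
    (x τ, τ) ∈ Metric.ball z₀ ρ := by
  have h1 : dist ((x τ, τ) : E × ℝ) (s, t) ≤ ρ / 2 := by
    have h2 := hx.norm_sub_le hM hτ.1
    have h0 : 0 ≤ τ - t := sub_nonneg.2 hτ.1
    have h3 : τ - t ≤ h := by linarith [hτ.2]
    rw [dist_eq_norm, Prod.mk_sub_mk, Prod.norm_mk, Real.norm_of_nonneg h0]
    refine max_le ?_ ?_ <;> nlinarith
  rw [Metric.mem_ball] at hz ⊢
  linarith [dist_triangle ((x τ, τ) : E × ℝ) (s, t) z₀]

end Basic

/-! ### Trajectories of the modified system: existence, uniqueness, concatenation. -/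

section Trajectory

variable {E A B F : Type*} [NormedAddCommGroup E] [ProperSpace E]
  [MeasurableSpace E] [BorelSpace E] [NormedAddCommGroup F] {K : Set E}
  [MetricSpace A] [CompactSpace A] [MeasurableSpace A] [BorelSpace A]
  [MetricSpace B] [CompactSpace B] [MeasurableSpace B] [BorelSpace B]

theorem aestronglyMeasurable_control_comp {g : E → A → B → F}
    (hg : Continuous fun z : E × A × B => g z.1 z.2.1 z.2.2) {t : ℝ} {x : ℝ → E}
    (hx : ContinuousOn x (Set.Ici t)) (a : Control A t) (b : Control B t) :
    AEStronglyMeasurable (fun r => g (x r) (a.1 r) (b.1 r)) (volume.restrict (Set.Ici t)) :=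
  have hxm : AEMeasurable x (volume.restrict (Set.Ici t)) := hx.aemeasurable measurableSet_Ici
  hg.stronglyMeasurable.aestronglyMeasurable.comp_aemeasurable (hxm.prodMk (a.2.prodMk b.2))

theorem aestronglyMeasurable_zeroOn_comp (hK : IsClosed K) {g : E → A → B → F}
    (hg : Continuous fun z : E × A × B => g z.1 z.2.1 z.2.2) {t : ℝ} {x : ℝ → E}
    (hx : ContinuousOn x (Set.Ici t)) (a : Control A t) (b : Control B t) :
    AEStronglyMeasurable (fun r => zeroOn K g (x r) (a.1 r) (b.1 r))
      (volume.restrict (Set.Ici t)) := by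
  have hxm : AEMeasurable x (volume.restrict (Set.Ici t)) := hx.aemeasurable measurableSet_Ici
  have h2 : StronglyMeasurable fun z : E × A × B => zeroOn K g z.1 z.2.1 z.2.2 := by
    classical
    unfold zeroOn
    exact StronglyMeasurable.ite (hK.measurableSet.preimage measurable_fst)
      stronglyMeasurable_const hg.stronglyMeasurable
  exact h2.aestronglyMeasurable.comp_aemeasurable (hxm.prodMk (a.2.prodMk b.2))

theorem intervalIntegrable_zeroOn_comp (hK : IsClosed K) {g : E → A → B → F}
    (hg : Continuous fun z : E × A × B => g z.1 z.2.1 z.2.2) {t : ℝ} {x : ℝ → E}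
    (hx : ContinuousOn x (Set.Ici t)) (a : Control A t) (b : Control B t) {t₁ t₂ : ℝ}
    (h₁ : t ≤ t₁) (h₂ : t ≤ t₂) :
    IntervalIntegrable (fun r => zeroOn K g (x r) (a.1 r) (b.1 r)) volume t₁ t₂ := by
  suffices H : ∀ τ, t ≤ τ →
      IntervalIntegrable (fun r => zeroOn K g (x r) (a.1 r) (b.1 r)) volume t τ from
    (H t₁ h₁).symm.trans (H t₂ h₂)
  intro τ hτ
  have hcomp : IsCompact ((x '' Set.Icc t τ) ×ˢ (Set.univ : Set (A × B))) :=
    (isCompact_Icc.image_of_continuousOn (hx.mono fun r hr => hr.1)).prod isCompact_univ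
  obtain ⟨C, hC⟩ := hcomp.exists_bound_of_continuousOn hg.continuousOn
  refine intervalIntegrable_of_bounded (aestronglyMeasurable_zeroOn_comp hK hg hx a b) hτ
    (C := C) fun r hr => (norm_zeroOn_le _ _ _ _).trans ?_
  exact hC (x r, a.1 r, b.1 r) ⟨⟨r, ⟨hr.1.le, hr.2⟩, rfl⟩, trivial⟩

/-- The cost along a concatenation of trajectories. -/
theorem integral_zeroOn_glue (hK : IsClosed K) {c : E → A → B → F} [NormedSpace ℝ F]
    (hc : Continuous fun z : E × A × B => c z.1 z.2.1 z.2.2) {t t₁ T : ℝ}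
    (ht : t ≤ t₁) (hT : t₁ ≤ T) {a a'' : Control A t} {b b'' : Control B t}
    {a' : ℝ → A} {b' : ℝ → B} {x x' : ℝ → E}
    (hx : ContinuousOn ((Set.Iic t₁).piecewise x x') (Set.Ici t))
    (ha : ∀ᵐ τ ∂(volume.restrict (Set.Icc t t₁)), a''.1 τ = a.1 τ)
    (hb : ∀ᵐ τ ∂(volume.restrict (Set.Icc t t₁)), b''.1 τ = b.1 τ)
    (ha' : ∀ r, t₁ ≤ r → a''.1 r = a' r) (hb' : ∀ r, t₁ ≤ r → b''.1 r = b' r) :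
    ∫ r in t..T, zeroOn K c ((Set.Iic t₁).piecewise x x' r) (a''.1 r) (b''.1 r) =
      (∫ r in t..t₁, zeroOn K c (x r) (a.1 r) (b.1 r)) +
        ∫ r in t₁..T, zeroOn K c (x' r) (a' r) (b' r) := by
  rw [← intervalIntegral.integral_add_adjacent_intervals
    (intervalIntegrable_zeroOn_comp hK hc hx a'' b'' le_rfl ht)
    (intervalIntegrable_zeroOn_comp hK hc hx a'' b'' ht (ht.trans hT))]
  congr 1
  · refine intervalIntegral.integral_congr_ae ?_
    filter_upwards [ae_uIoc_of_ae_restrict_Icc ht le_rfl (ha.and hb)] with r hr hm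
    obtain ⟨h3, h4⟩ := hr hm
    rw [Set.uIoc_of_le ht] at hm
    rw [Set.piecewise_eq_of_mem _ _ _ (Set.mem_Iic.2 hm.2), h3, h4]
  · refine intervalIntegral.integral_congr_ae (ae_of_all _ fun r hr => ?_)
    rw [Set.uIoc_of_le hT] at hr
    rw [Set.piecewise_eq_of_notMem _ _ _ (Set.notMem_Iic.2 hr.1), ha' r hr.1.le, hb' r hr.1.le]

variable [NormedSpace ℝ E] {f : E → A → B → E} {L : NNReal} {M : ℝ}

/-- The unmodified equation has a Lipschitz right-hand side; its solution, stopped at the first time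
in `K`, is the modified trajectory. -/
theorem exists_isModifiedTrajectory (hK : IsClosed K)
    (hf : LipschitzWith L fun z : E × A × B => f z.1 z.2.1 z.2.2) (hM : ∀ s a b, ‖f s a b‖ ≤ M)
    (s : E) {t : ℝ} (a : Control A t) (b : Control B t) :
    ∃ x, IsModifiedTrajectory f K s t a.1 b.1 x := by
  obtain ⟨y, hyc, hy⟩ := exists_integral_solution (G := fun r x => f x (a.1 r) (b.1 r)) L.2
    (fun x hx => aestronglyMeasurable_control_comp hf.continuous hx.continuousOn a b)
    (fun r x => hM _ _ _) (fun r x x' => hf.norm_sub_le_of_snd_eq x x' _ _) s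
  have hfree : ∀ τ, t ≤ τ → (∀ r, t ≤ r → r < τ → y r ∉ K) →
      ∫ r in t..τ, f (y r) (a.1 r) (b.1 r) = ∫ r in t..τ, zeroOn K f (y r) (a.1 r) (b.1 r) := by
    intro τ hτ h
    refine intervalIntegral.integral_congr_ae (ae_uIoc_of_ae_restrict_Icc hτ le_rfl ?_)
    rw [← Measure.restrict_congr_set Ico_ae_eq_Icc]
    filter_upwards [ae_restrict_mem measurableSet_Ico] with r hr
    rw [zeroOn_of_notMem (h r hr.1 hr.2)]
  by_cases hD : (Set.Ici t ∩ y ⁻¹' K).Nonempty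
  swap
  · have hD' : ∀ r, t ≤ r → y r ∉ K := fun r hr h => hD ⟨r, hr, h⟩
    refine ⟨y, hyc.continuousOn, fun τ hτ => ?_, fun τ hτ h => absurd h (hD' τ hτ)⟩
    rw [hy τ hτ, hfree τ hτ fun r hr _ => hD' r hr]
  set σ := sInf (Set.Ici t ∩ y ⁻¹' K) with hσ
  have hbdd : BddBelow (Set.Ici t ∩ y ⁻¹' K) := ⟨t, fun r hr => hr.1⟩
  obtain ⟨hσt, hσK⟩ : σ ∈ Set.Ici t ∩ y ⁻¹' K :=
    (isClosed_Ici.inter (hK.preimage hyc)).csInf_mem hD hbdd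
  have hbefore : ∀ r, t ≤ r → r < σ → y r ∉ K := fun r hr hrσ h =>
    notMem_of_lt_csInf hrσ hbdd ⟨hr, h⟩
  have hxc : Continuous fun τ => y (min τ σ) := by fun_prop
  have hint : ∀ τ, t ≤ τ → τ ≤ σ → y τ = s + ∫ r in t..τ,
      zeroOn K f (y (min r σ)) (a.1 r) (b.1 r) := by
    intro τ hτ hτσ
    rw [hy τ hτ, hfree τ hτ fun r hr hrτ => hbefore r hr (hrτ.trans_le hτσ)]
    congr 1
    refine intervalIntegral.integral_congr fun r hr => ?_
    rw [Set.uIcc_of_le hτ] at hr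
    simp only [min_eq_left (hr.2.trans hτσ)]
  refine ⟨fun τ => y (min τ σ), hxc.continuousOn, fun τ hτ => ?_, fun τ hτ h τ' hτ' => ?_⟩
  · rcases le_total τ σ with h | h
    · simp only [min_eq_left h]
      exact hint τ hτ h
    · simp only [min_eq_right h]
      rw [hint σ hσt le_rfl, ← intervalIntegral.integral_add_adjacent_intervals
        (intervalIntegrable_zeroOn_comp hK hf.continuous hxc.continuousOn a b le_rfl hσt)
        (intervalIntegrable_zeroOn_comp hK hf.continuous hxc.continuousOn a b hσt hτ)]
      have h0 : ∫ r in σ..τ, zeroOn K f (y (min r σ)) (a.1 r) (b.1 r) = 0 := by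
        refine intervalIntegral.integral_zero_ae (ae_of_all _ fun r hr => ?_)
        rw [Set.uIoc_of_le h] at hr
        rw [min_eq_right hr.1.le]
        exact zeroOn_of_mem (K := K) hσK _ _
      rw [h0, add_zero]
  · have hστ : σ ≤ τ := by
      by_contra hlt
      rw [not_le] at hlt
      simp only [min_eq_left hlt.le] at h
      exact hbefore τ hτ hlt h
    simp only [min_eq_right hστ, min_eq_right (hστ.trans hτ')]

theorem IsModifiedTrajectory.sub_eq_integral (hK : IsClosed K)
    (hf : LipschitzWith L fun z : E × A × B => f z.1 z.2.1 z.2.2) {s : E} {t : ℝ}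
    {a : Control A t} {b : Control B t} {x : ℝ → E}
    (hx : IsModifiedTrajectory f K s t a.1 b.1 x) {t₁ t₂ : ℝ} (h₁ : t ≤ t₁) (h₂ : t ≤ t₂) :
    x t₂ - x t₁ = ∫ r in t₁..t₂, zeroOn K f (x r) (a.1 r) (b.1 r) := by
  rw [hx.integral_eq t₁ h₁, hx.integral_eq t₂ h₂, add_sub_add_left_eq_sub]
  exact intervalIntegral.integral_interval_sub_left
    (intervalIntegrable_zeroOn_comp hK hf.continuous hx.continuousOn a b le_rfl h₂)
    (intervalIntegrable_zeroOn_comp hK hf.continuous hx.continuousOn a b le_rfl h₁)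

/-- A trajectory is determined on `[t, r]` by the restrictions of the controls to `[t, r]`. -/
theorem IsModifiedTrajectory.eqOn (hK : IsClosed K)
    (hf : LipschitzWith L fun z : E × A × B => f z.1 z.2.1 z.2.2) {s : E} {t r : ℝ}
    {a a' : Control A t} {b b' : Control B t} {x x' : ℝ → E}
    (hx : IsModifiedTrajectory f K s t a.1 b.1 x)
    (hx' : IsModifiedTrajectory f K s t a'.1 b'.1 x')
    (ha : ∀ᵐ τ ∂(volume.restrict (Set.Icc t r)), a.1 τ = a'.1 τ)
    (hb : ∀ᵐ τ ∂(volume.restrict (Set.Icc t r)), b.1 τ = b'.1 τ) :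
    Set.EqOn x x' (Set.Icc t r) := by
  intro τ₀ hτ₀
  have htr : t ≤ r := hτ₀.1.trans hτ₀.2
  have hxr : ContinuousOn x (Set.Icc t r) := hx.continuousOn.mono fun _ h => h.1
  have hxr' : ContinuousOn x' (Set.Icc t r) := hx'.continuousOn.mono fun _ h => h.1
  -- `σ` is the first time at which either trajectory is in `K`, or `r` if there is none. Before `σ`
  -- both obey the Lipschitz equation, so Grönwall applies there in spite of the discontinuity.
  obtain ⟨σ, hσ, hbefore, hafter⟩ : ∃ σ ∈ Set.Icc t r,
      (∀ τ ∈ Set.Ico t σ, x τ ∉ K ∧ x' τ ∉ K) ∧ (σ = r ∨ x σ ∈ K ∨ x' σ ∈ K) := by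
    set D := (Set.Icc t r ∩ x ⁻¹' K) ∪ (Set.Icc t r ∩ x' ⁻¹' K) with hD
    by_cases hne : D.Nonempty
    · have hbdd : BddBelow D := ⟨t, fun τ hτ => hτ.elim (fun h => h.1.1) fun h => h.1.1⟩
      have hm : sInf D ∈ D := IsClosed.csInf_mem
        ((hxr.preimage_isClosed_of_isClosed isClosed_Icc hK).union
          (hxr'.preimage_isClosed_of_isClosed isClosed_Icc hK)) hne hbdd
      have hmI : sInf D ∈ Set.Icc t r := hm.elim (fun h => h.1) fun h => h.1
      refine ⟨sInf D, hmI, fun τ hτ => ⟨fun h => ?_, fun h => ?_⟩,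
        Or.inr (hm.imp (fun h => h.2) fun h => h.2)⟩
      · exact notMem_of_lt_csInf hτ.2 hbdd (Or.inl ⟨⟨hτ.1, hτ.2.le.trans hmI.2⟩, h⟩)
      · exact notMem_of_lt_csInf hτ.2 hbdd (Or.inr ⟨⟨hτ.1, hτ.2.le.trans hmI.2⟩, h⟩)
    · refine ⟨r, ⟨htr, le_rfl⟩, fun τ hτ => ⟨fun h => ?_, fun h => ?_⟩, Or.inl rfl⟩
      · exact hne ⟨τ, Or.inl ⟨⟨hτ.1, hτ.2.le⟩, h⟩⟩
      · exact hne ⟨τ, Or.inr ⟨⟨hτ.1, hτ.2.le⟩, h⟩⟩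
  have hdc : ContinuousOn (fun τ => ‖x τ - x' τ‖) (Set.Icc t σ) :=
    ((hxr.sub hxr').norm).mono (Set.Icc_subset_Icc_right hσ.2)
  have hzero : ∀ τ ∈ Set.Icc t σ, ‖x τ - x' τ‖ = 0 := by
    refine eq_zero_of_le_integral L.2 hdc (fun _ _ => norm_nonneg _) fun τ hτ => ?_
    rw [hx.integral_eq τ hτ.1, hx'.integral_eq τ hτ.1, add_sub_add_left_eq_sub,
      ← intervalIntegral.integral_sub
        (intervalIntegrable_zeroOn_comp hK hf.continuous hx.continuousOn a b le_rfl hτ.1)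
        (intervalIntegrable_zeroOn_comp hK hf.continuous hx'.continuousOn a' b' le_rfl hτ.1),
      ← intervalIntegral.integral_const_mul]
    refine intervalIntegral.norm_integral_le_of_norm_le hτ.1 ?_ ?_
    · have hne : ∀ᵐ ρ : ℝ, ρ ≠ σ := by simp [ae_iff]
      have h1 := ae_uIoc_of_ae_restrict_Icc hτ.1 (hτ.2.trans hσ.2) (ha.and hb)
      filter_upwards [hne, h1] with ρ hρσ hρ hm
      obtain ⟨h2, h3⟩ := hρ (by rwa [Set.uIoc_of_le hτ.1])
      obtain ⟨h4, h5⟩ := hbefore ρ ⟨hm.1.le, lt_of_le_of_ne (hm.2.trans hτ.2) hρσ⟩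
      rw [zeroOn_of_notMem h4, zeroOn_of_notMem h5, h2, h3]
      exact hf.norm_sub_le_of_snd_eq _ _ _ _
    · refine (ContinuousOn.intervalIntegrable_of_Icc hτ.1
        (hdc.mono (Set.Icc_subset_Icc_right hτ.2))).const_mul _
  have heq : ∀ τ ∈ Set.Icc t σ, x τ = x' τ := fun τ hτ =>
    sub_eq_zero.1 (norm_eq_zero.1 (hzero τ hτ))
  rcases le_total τ₀ σ with h | h
  · exact heq τ₀ ⟨hτ₀.1, h⟩
  · have hσσ := heq σ ⟨hσ.1, le_rfl⟩
    rcases hafter with h1 | h1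
    · have : τ₀ = σ := le_antisymm (h1 ▸ hτ₀.2) h
      rw [this, hσσ]
    -- The trajectories coincide at `σ`, so both are in `K` at that time and both stay frozen at the
    -- same point.
    · have h2 : x σ ∈ K := h1.elim id fun h => hσσ ▸ h
      rw [hx.frozen σ hσ.1 h2 τ₀ h, hx'.frozen σ hσ.1 (hσσ ▸ h2) τ₀ h, hσσ]

theorem IsModifiedTrajectory.tail (hK : IsClosed K)
    (hf : LipschitzWith L fun z : E × A × B => f z.1 z.2.1 z.2.2) {s : E} {t t₁ : ℝ}
    {a : Control A t} {b : Control B t} {x : ℝ → E}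
    (hx : IsModifiedTrajectory f K s t a.1 b.1 x) (h : t ≤ t₁) :
    IsModifiedTrajectory f K (x t₁) t₁ a.1 b.1 x where
  continuousOn := hx.continuousOn.mono (Set.Ici_subset_Ici.2 h)
  integral_eq τ hτ := by
    rw [← hx.sub_eq_integral hK hf h (h.trans hτ), add_sub_cancel]
  frozen τ hτ := hx.frozen τ (h.trans hτ)

/-- Concatenation of trajectories. -/
theorem IsModifiedTrajectory.glue (hK : IsClosed K)
    (hf : LipschitzWith L fun z : E × A × B => f z.1 z.2.1 z.2.2) {s : E} {t t₁ : ℝ}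
    (ht : t ≤ t₁) {a a'' : Control A t} {b b'' : Control B t}
    {a' : ℝ → A} {b' : ℝ → B} {x x' : ℝ → E}
    (hx : IsModifiedTrajectory f K s t a.1 b.1 x)
    (hx' : IsModifiedTrajectory f K (x t₁) t₁ a' b' x')
    (ha : ∀ᵐ τ ∂(volume.restrict (Set.Icc t t₁)), a''.1 τ = a.1 τ)
    (hb : ∀ᵐ τ ∂(volume.restrict (Set.Icc t t₁)), b''.1 τ = b.1 τ)
    (ha' : ∀ r, t₁ ≤ r → a''.1 r = a' r) (hb' : ∀ r, t₁ ≤ r → b''.1 r = b' r) :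
    IsModifiedTrajectory f K s t a''.1 b''.1 ((Set.Iic t₁).piecewise x x') := by
  have hlow : ∀ r, r ≤ t₁ → (Set.Iic t₁).piecewise x x' r = x r := fun r hr =>
    Set.piecewise_eq_of_mem _ _ _ hr
  have hhigh : ∀ r, t₁ ≤ r → (Set.Iic t₁).piecewise x x' r = x' r := by
    intro r hr
    rcases hr.eq_or_lt with rfl | h
    · rw [hlow _ le_rfl, hx'.initial]
    · exact Set.piecewise_eq_of_notMem _ _ _ (not_le.2 h)
  have hc : ContinuousOn ((Set.Iic t₁).piecewise x x') (Set.Ici t) := by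
    have h1 : ContinuousOn ((Set.Iic t₁).piecewise x x') (Set.Icc t t₁) :=
      (hx.continuousOn.mono fun r hr => hr.1).congr fun r hr => hlow r hr.2
    have h2 : ContinuousOn ((Set.Iic t₁).piecewise x x') (Set.Ici t₁) :=
      hx'.continuousOn.congr fun r hr => hhigh r hr
    have := h1.union_of_isClosed h2 isClosed_Icc isClosed_Ici
    rwa [Set.Icc_union_Ici_eq_Ici ht] at this
  have hint1 : ∀ τ, t ≤ τ → τ ≤ t₁ →
      ∫ r in t..τ, zeroOn K f ((Set.Iic t₁).piecewise x x' r) (a''.1 r) (b''.1 r)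
        = ∫ r in t..τ, zeroOn K f (x r) (a.1 r) (b.1 r) := by
    intro τ h1 h2
    refine intervalIntegral.integral_congr_ae ?_
    filter_upwards [ae_uIoc_of_ae_restrict_Icc h1 h2 (ha.and hb)] with r hr hm
    obtain ⟨h3, h4⟩ := hr hm
    rw [Set.uIoc_of_le h1] at hm
    rw [hlow r (hm.2.trans h2), h3, h4]
  refine ⟨hc, fun τ hτ => ?_, fun τ hτ h τ' hτ' => ?_⟩
  · rcases le_total τ t₁ with h | h
    · rw [hlow τ h, hint1 τ hτ h, hx.integral_eq τ hτ]
    · rw [← intervalIntegral.integral_add_adjacent_intervals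
        (intervalIntegrable_zeroOn_comp hK hf.continuous hc a'' b'' le_rfl ht)
        (intervalIntegrable_zeroOn_comp hK hf.continuous hc a'' b'' ht hτ),
        hint1 t₁ ht le_rfl, ← add_assoc, ← hx.integral_eq t₁ ht, hhigh τ h, hx'.integral_eq τ h]
      congr 1
      refine intervalIntegral.integral_congr fun r hr => ?_
      rw [Set.uIcc_of_le h] at hr
      simp only [hhigh r hr.1, ha' r hr.1, hb' r hr.1]
  · rcases le_total τ t₁ with h1 | h1
    · rw [hlow τ h1] at h ⊢
      rcases le_total τ' t₁ with h2 | h2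
      · rw [hlow τ' h2, hx.frozen τ hτ h τ' hτ']
      · have h3 := hx.frozen τ hτ h t₁ h1
        rw [hhigh τ' h2, hx'.frozen t₁ Set.self_mem_Ici (by rwa [hx'.initial, h3]) τ' h2,
          hx'.initial, h3]
    · rw [hhigh τ h1] at h ⊢
      rw [hhigh τ' (h1.trans hτ')]
      exact hx'.frozen τ h1 h τ' hτ'

end Trajectory

/-! ### Bounds on the value through strategies and controls. -/

section Value

variable {E A B : Type*} [NormedAddCommGroup E] [NormedSpace ℝ E] {K : Set E}
  [MeasurableSpace A] [MeasurableSpace B] {f : E → A → B → E} {c : E → A → B → ℝ} {T : ℝ}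

theorem exists_cost_lt {s : E} {t r : ℝ} (h : truncatedValue f c K T (s, t) < (r : EReal))
    (β : Strategy A B t) : ∃ (a : Control A t) (x : ℝ → E),
      IsModifiedTrajectory f K s t a.1 (β.1 a).1 x ∧
        ∫ τ in t..T, zeroOn K c (x τ) (a.1 τ) ((β.1 a).1 τ) < r := by
  have h1 := (le_iSup _ β).trans_lt h
  simp only [iInf_lt_iff, EReal.coe_lt_coe_iff] at h1
  obtain ⟨a, x, hx, hr⟩ := h1
  exact ⟨a, x, hx, hr⟩

theorem exists_strategy_lt_cost {s : E} {t r : ℝ}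
    (h : (r : EReal) < truncatedValue f c K T (s, t)) :
    ∃ β : Strategy A B t, ∀ (a : Control A t) (x : ℝ → E),
      IsModifiedTrajectory f K s t a.1 (β.1 a).1 x →
        r < ∫ τ in t..T, zeroOn K c (x τ) (a.1 τ) ((β.1 a).1 τ) := by
  obtain ⟨β, hβ⟩ := lt_iSup_iff.1 h
  refine ⟨β, fun a x hx => EReal.coe_lt_coe_iff.1 (hβ.trans_le ?_)⟩
  exact (iInf_le _ a).trans ((iInf_le _ x).trans (iInf_le _ hx))

/-- The value also takes an infimum over trajectories, and an empty infimum is `⊤`; hence an upper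
bound has to exhibit a trajectory, while a lower bound does not. -/
theorem truncatedValue_le {z : E × ℝ} {r : ℝ} (h : ∀ β : Strategy A B z.2,
    ∃ (a : Control A z.2) (x : ℝ → E), IsModifiedTrajectory f K z.1 z.2 a.1 (β.1 a).1 x ∧
      ∫ τ in z.2..T, zeroOn K c (x τ) (a.1 τ) ((β.1 a).1 τ) ≤ r) :
    truncatedValue f c K T z ≤ (r : EReal) := by
  refine iSup_le fun β => ?_
  obtain ⟨a, x, hx, hr⟩ := h β
  exact (iInf_le _ a).trans ((iInf_le _ x).trans ((iInf_le _ hx).trans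
    (EReal.coe_le_coe_iff.2 hr)))

theorem le_truncatedValue {z : E × ℝ} {r : ℝ} (β : Strategy A B z.2)
    (h : ∀ (a : Control A z.2) (x : ℝ → E), IsModifiedTrajectory f K z.1 z.2 a.1 (β.1 a).1 x →
      r ≤ ∫ τ in z.2..T, zeroOn K c (x τ) (a.1 τ) ((β.1 a).1 τ)) :
    (r : EReal) ≤ truncatedValue f c K T z :=
  le_iSup_of_le β (le_iInf fun a => le_iInf fun x => le_iInf fun hx =>
    EReal.coe_le_coe_iff.2 (h a x hx))

/-- The control that is constant. -/
def Control.const {A : Type*} [MeasurableSpace A] (t : ℝ) (a : A) : Control A t :=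
  ⟨fun _ => a, aemeasurable_const⟩

/-- The strategy that uses the same value whatever the opponent does. -/
def Strategy.const (A : Type*) {B : Type*} [MeasurableSpace A] [MeasurableSpace B] (t : ℝ)
    (b : B) : Strategy A B t :=
  ⟨fun _ => Control.const t b, fun _ _ _ _ _ => ae_of_all _ fun _ => rfl⟩

/-- The strategy from time `t₁` on that responds as `β` does when the opponent has followed `a`
before time `t₁`. -/
noncomputable def Strategy.restart {t t₁ : ℝ} (β : Strategy A B t) (h : t ≤ t₁)
    (a : Control A t) : Strategy A B t₁ :=
  ⟨fun a' => (β.1 (a.glue a')).tail h, fun r hr a₁ a₂ heq => by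
    refine ae_restrict_Icc_mono h le_rfl (β.2 r (h.trans hr) _ _ ?_)
    refine ae_restrict_Icc_of_glue (t₁ := t₁) (ae_restrict_Icc_of_lt fun τ hτ => ?_) ?_
    · rw [Control.glue_of_lt _ _ hτ, Control.glue_of_lt _ _ hτ]
    · filter_upwards [heq, ae_restrict_mem measurableSet_Icc] with τ hτ hm
      rw [Control.glue_of_ge _ _ hm.1, Control.glue_of_ge _ _ hm.1, hτ]⟩

/-- A radius, a time step and a first-order expansion that are valid near a point. -/
theorem exists_local_expansion {E : Type*} [NormedAddCommGroup E] [NormedSpace ℝ E] {T : ℝ}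
    {M : ℝ} (hM0 : 0 ≤ M) {z₀ : E × ℝ} (hz₀ : z₀ ∈ openStrip E T)
    {φ : E × ℝ → ℝ} {φ' : E × ℝ →L[ℝ] ℝ} (hφ : HasStrictFDerivAt φ φ' z₀) {P : E × ℝ → Prop}
    (hP : ∀ᶠ z in 𝓝 z₀, P z) {θ : ℝ} (hθ : 0 < θ) :
    ∃ ρ > 0, ∃ h > 0, ∃ ε ≥ 0, (M + 1) * h ≤ ρ / 2 ∧ ε * (M + 1) * h = θ * h / 4 ∧
      (∀ z ∈ Metric.ball z₀ ρ, P z ∧ z.2 ≤ T) ∧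
      ∀ z ∈ Metric.ball z₀ ρ, ∀ z' ∈ Metric.ball z₀ ρ,
        |φ z - φ z' - φ' (z - z')| ≤ ε * ‖z - z'‖ := by
  -- Along a path of speed at most `M + 1` this `ε` costs at most `θh/4` in time `h`, a quarter of
  -- the gain `θh`. Strict differentiability makes the expansion uniform over base points near `z₀`.
  have hε : 0 < θ / (4 * (M + 1)) := by positivity
  have hT : ∀ᶠ z : E × ℝ in 𝓝 z₀, z.2 ≤ T :=
    (continuous_snd.tendsto z₀).eventually (Iic_mem_nhds hz₀.2.2)
  obtain ⟨ρ₁, hρ₁, h₁⟩ := Metric.eventually_nhds_iff_ball.1 (hP.and hT)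
  obtain ⟨ρ₂, hρ₂, h₂⟩ := Metric.eventually_nhds_iff_ball.1 (hφ.isLittleO.def hε)
  refine ⟨min ρ₁ ρ₂, lt_min hρ₁ hρ₂, min ρ₁ ρ₂ / (2 * (M + 1)), by positivity,
    θ / (4 * (M + 1)), hε.le, ?_, ?_, fun z hz => h₁ z ?_, fun z hz z' hz' => ?_⟩
  · field_simp; rfl
  · field_simp
  · exact Metric.ball_subset_ball (min_le_left _ _) hz
  · have hb := Metric.ball_subset_ball (x := z₀) (min_le_right ρ₁ ρ₂)
    refine h₂ (z, z') ?_
    rw [← ball_prod_same]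
    exact ⟨hb hz, hb hz'⟩

end Value

/-! ### Dynamic programming inequalities and their local form. -/

section DynamicProgramming

variable {E A B : Type*} [NormedAddCommGroup E] [NormedSpace ℝ E] [ProperSpace E]
  [MeasurableSpace E] [BorelSpace E] {K : Set E}
  [MetricSpace A] [CompactSpace A] [MeasurableSpace A] [BorelSpace A]
  [MetricSpace B] [CompactSpace B] [MeasurableSpace B] [BorelSpace B]
  {f : E → A → B → E} {c : E → A → B → ℝ} {T : ℝ} {L : NNReal} {M : ℝ}

/-- Against any strategy, a given control can be continued from time `t₁` on at a cost that is
arbitrarily close to the value at the point reached. -/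
theorem exists_continuation_cost_lt (hK : IsClosed K)
    (hf : LipschitzWith L fun z : E × A × B => f z.1 z.2.1 z.2.2)
    (hc : Continuous fun z : E × A × B => c z.1 z.2.1 z.2.2) {s : E} {t t₁ r : ℝ}
    (ht : t ≤ t₁) (hT : t₁ ≤ T) (β : Strategy A B t) {a : Control A t} {x : ℝ → E}
    (hx : IsModifiedTrajectory f K s t a.1 (β.1 a).1 x)
    (hr : truncatedValue f c K T (x t₁, t₁) < (r : EReal)) :
    ∃ (a' : Control A t) (x' : ℝ → E), IsModifiedTrajectory f K s t a'.1 (β.1 a').1 x' ∧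
      ∫ τ in t..T, zeroOn K c (x' τ) (a'.1 τ) ((β.1 a').1 τ) <
        (∫ τ in t..t₁, zeroOn K c (x τ) (a.1 τ) ((β.1 a).1 τ)) + r := by
  obtain ⟨a', x', hx', hcost⟩ := exists_cost_lt hr (β.restart ht a)
  have ha : ∀ᵐ τ ∂(volume.restrict (Set.Icc t t₁)), (a.glue a').1 τ = a.1 τ :=
    ae_restrict_Icc_of_lt fun τ hτ => Control.glue_of_lt _ _ hτ
  have hb := β.2 t₁ ht _ _ ha
  have ha' : ∀ τ, t₁ ≤ τ → (a.glue a').1 τ = a'.1 τ := fun τ hτ => Control.glue_of_ge _ _ hτ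
  have hb' : ∀ τ, t₁ ≤ τ → (β.1 (a.glue a')).1 τ = ((β.restart ht a).1 a').1 τ := fun _ _ => rfl
  have hglue := hx.glue hK hf ht hx' ha hb ha' hb'
  refine ⟨a.glue a', _, hglue, ?_⟩
  rw [integral_zeroOn_glue hK hc ht hT hglue.continuousOn ha hb ha' hb']
  gcongr

/-- Feedback of the opponent's current action through `ψ` before time `t₁`, followed by a strategy
that depends on the point reached at time `t₁`. -/
theorem exists_strategy_feedback (hK : IsClosed K)
    (hf : LipschitzWith L fun z : E × A × B => f z.1 z.2.1 z.2.2) (hM : ∀ s a b, ‖f s a b‖ ≤ M)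
    (hc : Continuous fun z : E × A × B => c z.1 z.2.1 z.2.2) (s : E) {t t₁ : ℝ}
    (ht : t ≤ t₁) (hT : t₁ ≤ T) {ψ : A → B} (hψ : Measurable ψ) (S : E → Strategy A B t₁) :
    ∃ β : Strategy A B t, ∀ (a : Control A t) (x : ℝ → E),
      IsModifiedTrajectory f K s t a.1 (β.1 a).1 x →
      ∃ X : ℝ → E, IsModifiedTrajectory f K s t a.1 (ψ ∘ a.1) X ∧
        IsModifiedTrajectory f K (X t₁) t₁ (a.tail ht).1 ((S (X t₁)).1 (a.tail ht)).1 x ∧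
        ∫ τ in t..T, zeroOn K c (x τ) (a.1 τ) ((β.1 a).1 τ) =
          (∫ τ in t..t₁, zeroOn K c (X τ) (a.1 τ) (ψ (a.1 τ))) +
            ∫ τ in t₁..T, zeroOn K c (x τ) ((a.tail ht).1 τ)
              (((S (X t₁)).1 (a.tail ht)).1 τ) := by
  let fb : Control A t → Control B t := fun a => ⟨ψ ∘ a.1, hψ.comp_aemeasurable a.2⟩
  choose X hX using fun a => exists_isModifiedTrajectory hK hf hM s a (fb a)
  -- For each fixed `a` only the single strategy `S (X a t₁)` is used, so `S` may depend on the
  -- point in a nonmeasurable way.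
  let b : Control A t → Control B t := fun a => (fb a).glue ((S (X a t₁)).1 (a.tail ht))
  have hlow : ∀ a τ, τ < t₁ → (b a).1 τ = ψ (a.1 τ) := fun a τ hτ => Control.glue_of_lt _ _ hτ
  have hhigh : ∀ a τ, t₁ ≤ τ → (b a).1 τ = ((S (X a t₁)).1 (a.tail ht)).1 τ :=
    fun a τ hτ => Control.glue_of_ge _ _ hτ
  have hb : ∀ a, ∀ᵐ τ ∂(volume.restrict (Set.Icc t t₁)), (b a).1 τ = (fb a).1 τ :=
    fun a => ae_restrict_Icc_of_lt (hlow a)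
  refine ⟨⟨b, fun r hr a a' heq => ?_⟩, fun a x hx => ⟨X a, hX a, ?_⟩⟩
  · have hfb : ∀ r', r' ≤ r →
        ∀ᵐ τ ∂(volume.restrict (Set.Icc t r')), (fb a).1 τ = (fb a').1 τ := fun r' hr' => by
      filter_upwards [ae_restrict_Icc_mono le_rfl hr' heq] with τ hτ
      exact congrArg ψ hτ
    rcases le_total r t₁ with h | h
    · filter_upwards [hfb r le_rfl, ae_restrict_Icc_mono le_rfl h (hb a),
        ae_restrict_Icc_mono le_rfl h (hb a')] with τ h1 h2 h3
      rw [h2, h1, h3]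
    -- The strategy chosen at `t₁` depends on `a` only through its restriction to `[t, t₁]`, by
    -- uniqueness of trajectories; this makes the response nonanticipative.
    · have hXX : X a t₁ = X a' t₁ := (hX a).eqOn hK hf (hX a')
        (ae_restrict_Icc_mono le_rfl h heq) (hfb t₁ h) ⟨ht, le_rfl⟩
      refine ae_restrict_Icc_of_glue (t₁ := t₁) ?_ ?_
      · filter_upwards [hfb t₁ h, hb a, hb a'] with τ h1 h2 h3
        rw [h2, h1, h3]
      · have h1 := (S (X a t₁)).2 r h (a.tail ht) (a'.tail ht) (ae_restrict_Icc_mono ht le_rfl heq)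
        filter_upwards [h1, ae_restrict_mem measurableSet_Icc] with τ hτ hm
        rw [hhigh a τ hm.1, hhigh a' τ hm.1, hτ, hXX]
  · have hxX : Set.EqOn x (X a) (Set.Icc t t₁) :=
      IsModifiedTrajectory.eqOn hK hf (b := b a) hx (hX a) (ae_of_all _ fun _ => rfl) (hb a)
    refine ⟨?_, ?_⟩
    · rw [← hxX ⟨ht, le_rfl⟩]
      have h1 := IsModifiedTrajectory.tail hK hf (b := b a) hx ht
      refine h1.congr (fun _ _ => rfl) fun τ hτ => ?_
      rw [hhigh a τ hτ, hxX ⟨ht, le_rfl⟩]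
    · change ∫ τ in t..T, zeroOn K c (x τ) (a.1 τ) ((b a).1 τ) = _
      rw [← intervalIntegral.integral_add_adjacent_intervals
        (intervalIntegrable_zeroOn_comp hK hc hx.continuousOn a (b a) le_rfl ht)
        (intervalIntegrable_zeroOn_comp hK hc hx.continuousOn a (b a) ht (ht.trans hT))]
      congr 1
      · refine intervalIntegral.integral_congr_ae ?_
        filter_upwards [ae_uIoc_of_ae_restrict_Icc ht le_rfl (hb a)] with τ hτ hm
        rw [hτ hm]
        rw [Set.uIoc_of_le ht] at hm
        rw [hxX ⟨hm.1.le, hm.2⟩]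
        rfl
      · refine intervalIntegral.integral_congr fun τ hτ => ?_
        rw [Set.uIcc_of_le hT] at hτ
        simp only [hhigh a τ hτ.1]
        rfl

/-- First-order expansion of a test function along a trajectory. -/
theorem abs_increment_sub_integral_le (hK : IsClosed K)
    (hf : LipschitzWith L fun z : E × A × B => f z.1 z.2.1 z.2.2) (hM : ∀ s a b, ‖f s a b‖ ≤ M)
    (hM0 : 0 ≤ M) (hc : Continuous fun z : E × A × B => c z.1 z.2.1 z.2.2) {φ : E × ℝ → ℝ}
    {φ' : E × ℝ →L[ℝ] ℝ} {ε : ℝ} (hε : 0 ≤ ε) {U : Set (E × ℝ)}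
    (hφ : ∀ z ∈ U, ∀ z' ∈ U, |φ z - φ z' - φ' (z - z')| ≤ ε * ‖z - z'‖)
    {s : E} {t t₁ : ℝ} (ht : t ≤ t₁) {a : Control A t} {b : Control B t} {x : ℝ → E}
    (hx : IsModifiedTrajectory f K s t a.1 b.1 x) (hs : (s, t) ∈ U) (hs₁ : (x t₁, t₁) ∈ U) :
    |φ (x t₁, t₁) - φ (s, t) + (∫ τ in t..t₁, zeroOn K c (x τ) (a.1 τ) (b.1 τ)) -
      ∫ τ in t..t₁, (φ' (0, 1) + zeroOn K c (x τ) (a.1 τ) (b.1 τ) +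
        φ' (zeroOn K f (x τ) (a.1 τ) (b.1 τ), 0))| ≤ ε * (M + 1) * (t₁ - t) := by
  have hcI := intervalIntegrable_zeroOn_comp hK hc hx.continuousOn a b le_rfl ht
  have hfI := intervalIntegrable_zeroOn_comp hK hf.continuous hx.continuousOn a b le_rfl ht
  set p : E →L[ℝ] ℝ := φ'.comp (ContinuousLinearMap.inl ℝ E ℝ) with hp
  have hpv : ∀ v : E, φ' (v, 0) = p v := fun v => by simp [hp]
  have hpI : IntervalIntegrable (fun τ => p (zeroOn K f (x τ) (a.1 τ) (b.1 τ))) volume t t₁ :=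
    ⟨p.integrable_comp hfI.1, p.integrable_comp hfI.2⟩
  have hlin : φ' ((x t₁, t₁) - (s, t)) =
      (∫ τ in t..t₁, p (zeroOn K f (x τ) (a.1 τ) (b.1 τ))) + (t₁ - t) * φ' (0, 1) := by
    rw [p.intervalIntegral_comp_comm hfI, ← hx.sub_eq_integral hK hf le_rfl ht, hx.initial,
      ← hpv, ← smul_eq_mul, ← map_smul, ← map_add]
    simp
  have hsum : ∫ τ in t..t₁, (φ' (0, 1) + zeroOn K c (x τ) (a.1 τ) (b.1 τ) +
        φ' (zeroOn K f (x τ) (a.1 τ) (b.1 τ), 0)) =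
      (t₁ - t) * φ' (0, 1) + (∫ τ in t..t₁, zeroOn K c (x τ) (a.1 τ) (b.1 τ)) +
        ∫ τ in t..t₁, p (zeroOn K f (x τ) (a.1 τ) (b.1 τ)) := by
    simp only [hpv]
    rw [intervalIntegral.integral_add (intervalIntegrable_const.add hcI) hpI,
      intervalIntegral.integral_add intervalIntegrable_const hcI, intervalIntegral.integral_const,
      smul_eq_mul]
  have hn : ‖((x t₁, t₁) : E × ℝ) - (s, t)‖ ≤ (M + 1) * (t₁ - t) := by
    have h0 : 0 ≤ t₁ - t := sub_nonneg.2 ht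
    rw [Prod.mk_sub_mk, Prod.norm_mk, Real.norm_of_nonneg h0]
    have := hx.norm_sub_le hM ht
    refine max_le ?_ ?_ <;> nlinarith
  calc _ = |φ (x t₁, t₁) - φ (s, t) - φ' ((x t₁, t₁) - (s, t))| := by
        rw [hsum, hlin]; congr 1; ring
    _ ≤ ε * ‖((x t₁, t₁) : E × ℝ) - (s, t)‖ := hφ _ hs₁ _ hs
    _ ≤ ε * ((M + 1) * (t₁ - t)) := by gcongr
    _ = _ := by ring

/-- If the value is below a test function near a point, and some constant action of the minimizer
makes the test function plus the running cost decrease at a positive rate, then the value is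
strictly below the test function near the point. -/
theorem truncatedValue_le_sub (hK : IsClosed K)
    (hf : LipschitzWith L fun z : E × A × B => f z.1 z.2.1 z.2.2) (hM : ∀ s a b, ‖f s a b‖ ≤ M)
    (hM0 : 0 ≤ M) (hc : Continuous fun z : E × A × B => c z.1 z.2.1 z.2.2) {z₀ : E × ℝ}
    (hz₀ : z₀ ∈ openStrip E T) {φ : E × ℝ → ℝ} {φ' : E × ℝ →L[ℝ] ℝ}
    (hφ : HasStrictFDerivAt φ φ' z₀)
    (hW : ∀ᶠ z in 𝓝 z₀, truncatedValue f c K T z ≤ (φ z : EReal)) {θ : ℝ} (hθ : 0 < θ) (a₀ : A)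
    (hH : ∀ᶠ s in 𝓝 z₀.1, ∀ b,
      φ' (0, 1) + zeroOn K c s a₀ b + φ' (zeroOn K f s a₀ b, 0) ≤ -θ) :
    ∃ δ > 0, ∀ᶠ z in 𝓝 z₀, truncatedValue f c K T z ≤ ((φ z - δ : ℝ) : EReal) := by
  have hP := hW.and ((continuous_fst.tendsto z₀).eventually hH)
  obtain ⟨ρ, hρ, h, hh, ε, hε, hhρ, hεθ, hball, hexp⟩ :=
    exists_local_expansion (M := M) hM0 hz₀ hφ hP hθ
  -- Of the gain `θh`, one quarter pays for the expansion error and one quarter for the suboptimal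
  -- continuation. As `h` is the same for all starting points in the half ball, so is the
  -- improvement.
  refine ⟨θ * h / 2, by positivity, ?_⟩
  filter_upwards [Metric.ball_mem_nhds z₀ (half_pos hρ)] with z hz
  obtain ⟨s, t⟩ := z
  refine truncatedValue_le fun β => ?_
  obtain ⟨x, hx⟩ := exists_isModifiedTrajectory hK hf hM s (Control.const t a₀)
    (β.1 (Control.const t a₀))
  have hmem : ∀ τ ∈ Set.Icc t (t + h), (x τ, τ) ∈ Metric.ball z₀ ρ := fun τ hτ =>
    hx.mem_ball hM hM0 hhρ hz hτ
  have ht : t ≤ t + h := by linarith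
  have h1 := hmem (t + h) ⟨ht, le_rfl⟩
  have hval : truncatedValue f c K T (x (t + h), t + h) <
      ((φ (x (t + h), t + h) + θ * h / 4 : ℝ) : EReal) :=
    (hball _ h1).1.1.trans_lt (EReal.coe_lt_coe_iff.2 (by
      have : 0 < θ * h := by positivity
      linarith))
  obtain ⟨a', x', hx', hcost⟩ :=
    exists_continuation_cost_lt hK hf hc ht (hball _ h1).2 β hx hval
  refine ⟨a', x', hx', hcost.le.trans ?_⟩
  have hinc := abs_increment_sub_integral_le hK hf hM hM0 hc hε hexp ht hx
    (Metric.ball_subset_ball (by linarith) hz) h1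
  have hcI := intervalIntegrable_zeroOn_comp hK hc hx.continuousOn (Control.const t a₀)
    (β.1 (Control.const t a₀)) le_rfl ht
  have hfI := intervalIntegrable_zeroOn_comp hK hf.continuous hx.continuousOn
    (Control.const t a₀) (β.1 (Control.const t a₀)) le_rfl ht
  have hrate : ∫ τ in t..(t + h), (φ' (0, 1) +
      zeroOn K c (x τ) ((Control.const t a₀).1 τ) ((β.1 (Control.const t a₀)).1 τ) +
      φ' (zeroOn K f (x τ) ((Control.const t a₀).1 τ) ((β.1 (Control.const t a₀)).1 τ), 0)) ≤
        ∫ τ in t..(t + h), -θ := by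
    refine intervalIntegral.integral_mono_on ht ?_ intervalIntegrable_const fun τ hτ =>
      (hball _ (hmem τ hτ)).1.2 _
    exact (intervalIntegrable_const.add hcI).add
      ⟨(φ'.comp (ContinuousLinearMap.inl ℝ E ℝ)).integrable_comp hfI.1,
        (φ'.comp (ContinuousLinearMap.inl ℝ E ℝ)).integrable_comp hfI.2⟩
  rw [intervalIntegral.integral_const, smul_eq_mul, add_sub_cancel_left] at hrate
  rw [add_sub_cancel_left, hεθ] at hinc
  have := (abs_le.1 hinc).2
  linarith

/-- If the value is above a test function near a point, and some feedback of the maximizer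
makes the test function plus the running cost increase at a positive rate, then the value is
strictly above the test function near the point. -/
theorem add_le_truncatedValue [Nonempty B] (hK : IsClosed K)
    (hf : LipschitzWith L fun z : E × A × B => f z.1 z.2.1 z.2.2) (hM : ∀ s a b, ‖f s a b‖ ≤ M)
    (hM0 : 0 ≤ M) (hc : Continuous fun z : E × A × B => c z.1 z.2.1 z.2.2) {z₀ : E × ℝ}
    (hz₀ : z₀ ∈ openStrip E T) {φ : E × ℝ → ℝ} {φ' : E × ℝ →L[ℝ] ℝ}
    (hφ : HasStrictFDerivAt φ φ' z₀)
    (hW : ∀ᶠ z in 𝓝 z₀, (φ z : EReal) ≤ truncatedValue f c K T z) {θ : ℝ} (hθ : 0 < θ)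
    {ψ : A → B} (hψ : Measurable ψ)
    (hH : ∀ᶠ s in 𝓝 z₀.1, ∀ a,
      θ ≤ φ' (0, 1) + zeroOn K c s a (ψ a) + φ' (zeroOn K f s a (ψ a), 0)) :
    ∃ δ > 0, ∀ᶠ z in 𝓝 z₀, ((φ z + δ : ℝ) : EReal) ≤ truncatedValue f c K T z := by
  have hP := hW.and ((continuous_fst.tendsto z₀).eventually hH)
  obtain ⟨ρ, hρ, h, hh, ε, hε, hhρ, hεθ, hball, hexp⟩ :=
    exists_local_expansion (M := M) hM0 hz₀ hφ hP hθ
  have hθh : 0 < θ * h := by positivity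
  refine ⟨θ * h / 2, by positivity, ?_⟩
  filter_upwards [Metric.ball_mem_nhds z₀ (half_pos hρ)] with z hz
  obtain ⟨s, t⟩ := z
  have ht : t ≤ t + h := by linarith
  -- An almost optimal strategy is fixed for each possible arrival point. Outside the ball any
  -- strategy will do, since arrival there never occurs.
  have hS : ∀ y : E, ∃ S : Strategy A B (t + h), (y, t + h) ∈ Metric.ball z₀ ρ →
      ∀ (a : Control A (t + h)) (x : ℝ → E),
        IsModifiedTrajectory f K y (t + h) a.1 (S.1 a).1 x →
        φ (y, t + h) - θ * h / 4 <
          ∫ τ in (t + h)..T, zeroOn K c (x τ) (a.1 τ) ((S.1 a).1 τ) := by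
    intro y
    by_cases hy : (y, t + h) ∈ Metric.ball z₀ ρ
    · have : ((φ (y, t + h) - θ * h / 4 : ℝ) : EReal) < truncatedValue f c K T (y, t + h) :=
        (EReal.coe_lt_coe_iff.2 (by linarith)).trans_le (hball _ hy).1.1
      obtain ⟨S, hS⟩ := exists_strategy_lt_cost this
      exact ⟨S, fun _ => hS⟩
    · exact ⟨Strategy.const A _ (Classical.arbitrary B), fun h => absurd h hy⟩
  choose S hS using hS
  -- This is needed before any trajectory is available, so it is read off at `(s, t + h)` instead of
  -- at the arrival point.
  have hT : t + h ≤ T := by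
    refine (hball (s, t + h) ?_).2
    rw [Metric.mem_ball] at hz ⊢
    have h1 : dist ((s, t + h) : E × ℝ) (s, t) = h := by
      rw [dist_eq_norm, Prod.mk_sub_mk, Prod.norm_mk]
      simp [abs_of_pos hh, hh.le]
    have h2 : h ≤ ρ / 2 := by nlinarith
    linarith [dist_triangle ((s, t + h) : E × ℝ) (s, t) z₀]
  obtain ⟨β, hβ⟩ := exists_strategy_feedback (T := T) hK hf hM hc s ht hT hψ S
  refine le_truncatedValue β fun a x hx => ?_
  obtain ⟨X, hX, hxX, hcost⟩ := hβ a x hx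
  rw [hcost]
  have hmem : ∀ τ ∈ Set.Icc t (t + h), (X τ, τ) ∈ Metric.ball z₀ ρ := fun τ hτ =>
    hX.mem_ball hM hM0 hhρ hz hτ
  have h1 := hmem (t + h) ⟨ht, le_rfl⟩
  have hrest := hS _ h1 _ x hxX
  let b : Control B t := ⟨ψ ∘ a.1, hψ.comp_aemeasurable a.2⟩
  have hX' : IsModifiedTrajectory f K s t a.1 b.1 X := hX
  have hinc := abs_increment_sub_integral_le hK hf hM hM0 hc hε hexp ht hX'
    (Metric.ball_subset_ball (by linarith) hz) h1
  have hcI := intervalIntegrable_zeroOn_comp hK hc hX.continuousOn a b le_rfl ht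
  have hfI := intervalIntegrable_zeroOn_comp hK hf.continuous hX.continuousOn a b le_rfl ht
  have hrate : ∫ τ in t..(t + h), θ ≤ ∫ τ in t..(t + h), (φ' (0, 1) +
      zeroOn K c (X τ) (a.1 τ) (b.1 τ) + φ' (zeroOn K f (X τ) (a.1 τ) (b.1 τ), 0)) := by
    refine intervalIntegral.integral_mono_on ht intervalIntegrable_const ?_ fun τ hτ =>
      (hball _ (hmem τ hτ)).1.2 _
    exact (intervalIntegrable_const.add hcI).add
      ⟨(φ'.comp (ContinuousLinearMap.inl ℝ E ℝ)).integrable_comp hfI.1,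
        (φ'.comp (ContinuousLinearMap.inl ℝ E ℝ)).integrable_comp hfI.2⟩
  rw [intervalIntegral.integral_const, smul_eq_mul, add_sub_cancel_left] at hrate
  rw [add_sub_cancel_left, hεθ] at hinc
  have h2 := (abs_le.1 hinc).1
  have h3 : ∫ τ in t..(t + h), zeroOn K c (X τ) (a.1 τ) (ψ (a.1 τ)) =
    ∫ τ in t..(t + h), zeroOn K c (X τ) (a.1 τ) (b.1 τ) := rfl
  rw [h3]
  change φ (s, t) + θ * h / 2 ≤ _
  linarith

end DynamicProgramming

/-! ### Stability of near-optimal actions and feedbacks. -/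

section MinMax

variable {E A B : Type*} [TopologicalSpace E] [MetricSpace A]
  [MetricSpace B] [CompactSpace B] {G : E → A → B → ℝ}

theorem continuous_iSup_of_compact
    (hG : Continuous fun z : E × A × B => G z.1 z.2.1 z.2.2) :
    Continuous fun z : E × A => ⨆ b, G z.1 z.2 b := by
  have := isCompact_univ.continuous_sSup (f := fun (z : E × A) (b : B) => G z.1 z.2 b)
    (K := Set.univ) (by fun_prop)
  simpa only [Set.image_univ, sSup_range] using this

theorem bddAbove_range_of_continuous
    (hG : Continuous fun z : E × A × B => G z.1 z.2.1 z.2.2) (s : E) (a : A) :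
    BddAbove (Set.range (G s a)) :=
  isCompact_range (f := G s a) (by fun_prop) |>.bddAbove

/-- A nearly minimizing action at `s₀` remains good nearby; compactness of `B` makes the
neighbourhood independent of the response. -/
theorem exists_action_of_iInf_iSup_lt [Nonempty A]
    (hG : Continuous fun z : E × A × B => G z.1 z.2.1 z.2.2) {s₀ : E} {r : ℝ}
    (h : ⨅ a, ⨆ b, G s₀ a b < r) :
    ∃ a, ∃ θ > 0, ∀ᶠ s in 𝓝 s₀, ∀ b, G s a b ≤ r - θ := by
  obtain ⟨a, ha⟩ := exists_lt_of_ciInf_lt h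
  refine ⟨a, (r - ⨆ b, G s₀ a b) / 2, by linarith, ?_⟩
  have := isCompact_univ.eventually_forall_of_forall_eventually (x₀ := s₀) (K := (Set.univ : Set B))
    (P := fun s b => G s a b ≤ r - (r - ⨆ b, G s₀ a b) / 2) fun b _ => by
      have h1 : Continuous fun z : E × B => G z.1 a z.2 := by fun_prop
      have h2 : G s₀ a b < r - (r - ⨆ b, G s₀ a b) / 2 := by
        have := le_ciSup (bddAbove_range_of_continuous hG s₀ a) b
        linarith
      exact (h1.tendsto (s₀, b)).eventually (Iic_mem_nhds h2)
  filter_upwards [this] with s hs b using hs b trivial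

variable [CompactSpace A]

theorem continuous_iInf_iSup (hG : Continuous fun z : E × A × B => G z.1 z.2.1 z.2.2) :
    Continuous fun s => ⨅ a, ⨆ b, G s a b := by
  have := isCompact_univ.continuous_sInf (f := fun (s : E) (a : A) => ⨆ b, G s a b)
      (K := Set.univ) (continuous_iSup_of_compact hG)
  simpa only [Set.image_univ, sInf_range] using this

theorem bddBelow_range_iSup (hG : Continuous fun z : E × A × B => G z.1 z.2.1 z.2.2) (s : E) :
    BddBelow (Set.range fun a => ⨆ b, G s a b) :=
  (isCompact_range ((continuous_iSup_of_compact hG).comp (Continuous.prodMk_right s))).bddBelow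

/-- Compactness of `A` replaces a measurable selection: near each `a` a single response works, by
continuity, and finitely many such responses are patched together. -/
theorem exists_feedback_of_lt_iInf_iSup [Nonempty B] [MeasurableSpace A]
    [BorelSpace A] [MeasurableSpace B]
    (hG : Continuous fun z : E × A × B => G z.1 z.2.1 z.2.2) {s₀ : E} {r : ℝ}
    (h : r < ⨅ a, ⨆ b, G s₀ a b) :
    ∃ ψ : A → B, Measurable ψ ∧ ∃ θ > 0, ∀ᶠ s in 𝓝 s₀, ∀ a, r + θ ≤ G s a (ψ a) := by
  obtain ⟨r', hr', hr'H⟩ := exists_between h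
  suffices H : ∃ U : Set A, IsOpen U ∧ Set.univ ⊆ U ∧ ∃ ψ : A → B, Measurable ψ ∧
      ∀ᶠ s in 𝓝 s₀, ∀ a ∈ U, r' ≤ G s a (ψ a) by
    obtain ⟨U, -, hU, ψ, hψ, hs⟩ := H
    refine ⟨ψ, hψ, r' - r, by linarith, ?_⟩
    filter_upwards [hs] with s hs a
    linarith [hs a (hU trivial)]
  -- The induction runs over arbitrary sets `V`, so each carries an open `U ⊇ V`; patching along `U`
  -- is measurable, along `V` it need not be.
  refine isCompact_univ.induction_on (p := fun V : Set A => ∃ U : Set A, IsOpen U ∧ V ⊆ U ∧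
    ∃ ψ : A → B, Measurable ψ ∧ ∀ᶠ s in 𝓝 s₀, ∀ a ∈ U, r' ≤ G s a (ψ a)) ?_ ?_ ?_ ?_
  · exact ⟨∅, isOpen_empty, subset_rfl, fun _ => Classical.arbitrary B, measurable_const,
      Eventually.of_forall fun _ _ h => h.elim⟩
  · rintro V V' hV ⟨U, hU, hVU, hψ⟩
    exact ⟨U, hU, hV.trans hVU, hψ⟩
  · rintro V V' ⟨U, hU, hVU, ψ, hψ, hs⟩ ⟨U', hU', hVU', ψ', hψ', hs'⟩
    classical
    refine ⟨U ∪ U', hU.union hU', Set.union_subset_union hVU hVU', U.piecewise ψ ψ',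
      hψ.piecewise hU.measurableSet hψ', ?_⟩
    filter_upwards [hs, hs'] with s hs hs' a ha
    by_cases haU : a ∈ U
    · rw [Set.piecewise_eq_of_mem _ _ _ haU]
      exact hs a haU
    · rw [Set.piecewise_eq_of_notMem _ _ _ haU]
      exact hs' a (ha.resolve_left haU)
  · intro a _
    obtain ⟨b, hb⟩ := exists_lt_of_lt_ciSup
      (hr'H.trans_le (ciInf_le (bddBelow_range_iSup hG s₀) a))
    have h1 : Continuous fun z : E × A => G z.1 z.2 b := by fun_prop
    have h2 : ∀ᶠ z in 𝓝 s₀ ×ˢ 𝓝 a, r' ≤ G z.1 z.2 b := by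
      rw [← nhds_prod_eq]
      exact (h1.tendsto (s₀, a)).eventually (Ici_mem_nhds hb)
    obtain ⟨P, hP, Q, hQ, hPQ⟩ := eventually_prod_iff.1 h2
    obtain ⟨U, hUQ, hU, haU⟩ := mem_nhds_iff.1 hQ
    refine ⟨U, nhdsWithin_le_nhds (hU.mem_nhds haU), U, hU, subset_rfl, fun _ => b,
      measurable_const, ?_⟩
    filter_upwards [hP] with s hs a' ha' using hPQ hs (hUQ ha')

end MinMax

/-! ### Elementary bounds on semicontinuous envelopes. -/

section Envelope

variable {X : Type*} [TopologicalSpace X] {D : Set X} {u : X → EReal} {z : X}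

/-- The filter `𝓝[D] z` is not punctured, so the value at `z` itself counts. -/
theorem le_upperEnvelope (hz : z ∈ D) : u z ≤ upperEnvelope D u z :=
  le_limsup_of_frequently_le (Frequently.filter_mono
    (Filter.frequently_pure.2 le_rfl) (pure_le_nhdsWithin hz))

theorem lowerEnvelope_le (hz : z ∈ D) : lowerEnvelope D u z ≤ u z :=
  liminf_le_of_frequently_le (Frequently.filter_mono
    (Filter.frequently_pure.2 le_rfl) (pure_le_nhdsWithin hz))

theorem upperEnvelope_le {r : EReal} (h : ∀ᶠ y in 𝓝[D] z, u y ≤ r) : upperEnvelope D u z ≤ r :=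
  limsup_le_of_le (h := h)

theorem le_lowerEnvelope {r : EReal} (h : ∀ᶠ y in 𝓝[D] z, r ≤ u y) : r ≤ lowerEnvelope D u z :=
  le_liminf_of_le (h := h)

end Envelope

/-! ### The discontinuous Hamiltonian near the boundary of `K`. -/

section Hamiltonian

theorem eventually_mem_of_notMem_closure_compl {E : Type*} [TopologicalSpace E] {K : Set E}
    {s₀ : E} (h : s₀ ∉ closure Kᶜ) :
    ∀ᶠ s in 𝓝 s₀, s ∈ K := by
  rw [mem_closure_iff_frequently, not_frequently] at h
  simpa using h

variable {E A B : Type*} [NormedAddCommGroup E] [NormedSpace ℝ E] {K : Set E}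
  {f : E → A → B → E} {c : E → A → B → ℝ}

theorem hamiltonian_of_mem [Nonempty A] [Nonempty B] {s : E} (hs : s ∈ K) (p : E →L[ℝ] ℝ) :
    hamiltonian f c K s p = 0 := by
  simp [hamiltonian, zeroOn_of_mem hs]

theorem hamiltonian_of_notMem {s : E} (hs : s ∉ K) (p : E →L[ℝ] ℝ) :
    hamiltonian f c K s p = ⨅ a, ⨆ b, (c s a b + p (f s a b)) := by
  simp only [hamiltonian, zeroOn_of_notMem hs]

theorem hamiltonian_le_upperEnvelope (s : E)
    (p : E →L[ℝ] ℝ) : (hamiltonian f c K s p : EReal) ≤ upperEnvelope Set.univ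
      (fun q : E × (E →L[ℝ] ℝ) => (hamiltonian f c K q.1 q.2 : EReal)) (s, p) :=
  le_upperEnvelope (u := fun q : E × (E →L[ℝ] ℝ) => (hamiltonian f c K q.1 q.2 : EReal))
    (z := (s, p)) (Set.mem_univ _)

theorem lowerEnvelope_le_hamiltonian (s : E)
    (p : E →L[ℝ] ℝ) : lowerEnvelope Set.univ
      (fun q : E × (E →L[ℝ] ℝ) => (hamiltonian f c K q.1 q.2 : EReal)) (s, p) ≤
        (hamiltonian f c K s p : EReal) :=
  lowerEnvelope_le (u := fun q : E × (E →L[ℝ] ℝ) => (hamiltonian f c K q.1 q.2 : EReal))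
    (z := (s, p)) (Set.mem_univ _)

variable [MetricSpace A] [MetricSpace B] [CompactSpace B]

/-- Nearby states in `K` contribute the rate `q` and those off `K` the unmodified rate. Since `K` is
closed, the first kind occurs arbitrarily close only if `s₀ ∈ K`, the second only if `s₀ ∈ closure
Kᶜ`, so each kind is controlled by its own hypothesis. -/
theorem exists_action_zeroOn [Nonempty A] (hK : IsClosed K)
    (hf : Continuous fun z : E × A × B => f z.1 z.2.1 z.2.2)
    (hc : Continuous fun z : E × A × B => c z.1 z.2.1 z.2.2) {s₀ : E} {q : ℝ} (p : E →L[ℝ] ℝ)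
    (h₁ : s₀ ∈ K → q < 0)
    (h₂ : s₀ ∈ closure Kᶜ → q + ⨅ a, ⨆ b, (c s₀ a b + p (f s₀ a b)) < 0) :
    ∃ a, ∃ θ > 0, ∀ᶠ s in 𝓝 s₀, ∀ b, q + zeroOn K c s a b + p (zeroOn K f s a b) ≤ -θ := by
  have hG : Continuous fun z : E × A × B => c z.1 z.2.1 z.2.2 + p (f z.1 z.2.1 z.2.2) := by
    fun_prop
  by_cases hcl : s₀ ∈ closure Kᶜ
  · obtain ⟨a, θ, hθ, ha⟩ := exists_action_of_iInf_iSup_lt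
      (G := fun s a b => c s a b + p (f s a b)) hG (s₀ := s₀) (r := -q)
      (by linarith [h₂ hcl])
    by_cases hs₀ : s₀ ∈ K
    · refine ⟨a, min θ (-q), lt_min hθ (by linarith [h₁ hs₀]), ?_⟩
      filter_upwards [ha] with s hs b
      by_cases hsK : s ∈ K
      · rw [zeroOn_of_mem hsK, zeroOn_of_mem hsK, map_zero]
        linarith [min_le_right θ (-q)]
      · rw [zeroOn_of_notMem hsK, zeroOn_of_notMem hsK]
        linarith [min_le_left θ (-q), hs b]
    · refine ⟨a, θ, hθ, ?_⟩
      filter_upwards [ha, hK.isOpen_compl.mem_nhds hs₀] with s hs hsK b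
      rw [zeroOn_of_notMem hsK, zeroOn_of_notMem hsK]
      linarith [hs b]
  · have hev := eventually_mem_of_notMem_closure_compl hcl
    refine ⟨Classical.arbitrary A, -q, by linarith [h₁ hev.self_of_nhds], ?_⟩
    filter_upwards [hev] with s hs b
    rw [zeroOn_of_mem hs, zeroOn_of_mem hs, map_zero]
    linarith

variable [CompactSpace A]

/-- Approaching `s₀` through states off `K` with `p` fixed, the Hamiltonian tends to the unmodified
one at `s₀`, which is continuous in the state. Hence this limit lies between the two envelopes. -/
theorem frequently_hamiltonian (hf : Continuous fun z : E × A × B => f z.1 z.2.1 z.2.2)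
    (hc : Continuous fun z : E × A × B => c z.1 z.2.1 z.2.2) {s₀ : E} (hs₀ : s₀ ∈ closure Kᶜ)
    (p : E →L[ℝ] ℝ) {U : Set EReal}
    (hU : U ∈ 𝓝 (((⨅ a, ⨆ b, (c s₀ a b + p (f s₀ a b)) : ℝ)) : EReal)) :
    ∃ᶠ q : E × (E →L[ℝ] ℝ) in 𝓝[Set.univ] (s₀, p), (hamiltonian f c K q.1 q.2 : EReal) ∈ U := by
  have hG : Continuous fun z : E × A × B => c z.1 z.2.1 z.2.2 + p (f z.1 z.2.1 z.2.2) := by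
    fun_prop
  have h1 := (continuous_coe_real_ereal.comp
    (continuous_iInf_iSup (G := fun s a b => c s a b + p (f s a b)) hG)).tendsto s₀
  have h2 : ∃ᶠ s in 𝓝 s₀, (hamiltonian f c K s p : EReal) ∈ U := by
    refine ((mem_closure_iff_frequently.1 hs₀).and_eventually (h1.eventually_mem hU)).mono ?_
    rintro s ⟨hs, hsU⟩
    rw [hamiltonian_of_notMem hs]
    exact hsU
  rw [nhdsWithin_univ]
  exact Tendsto.frequently (f := fun s => (s, p))
    ((Continuous.prodMk continuous_id continuous_const).tendsto s₀) h2

theorem le_upperEnvelope_hamiltonian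
    (hf : Continuous fun z : E × A × B => f z.1 z.2.1 z.2.2)
    (hc : Continuous fun z : E × A × B => c z.1 z.2.1 z.2.2) {s₀ : E} (hs₀ : s₀ ∈ closure Kᶜ)
    (p : E →L[ℝ] ℝ) :
    (((⨅ a, ⨆ b, (c s₀ a b + p (f s₀ a b)) : ℝ)) : EReal) ≤ upperEnvelope Set.univ
      (fun q : E × (E →L[ℝ] ℝ) => (hamiltonian f c K q.1 q.2 : EReal)) (s₀, p) := by
  refine le_of_forall_lt_imp_le_of_dense fun r hr => ?_
  exact le_limsup_of_frequently_le (frequently_hamiltonian hf hc hs₀ p (Ici_mem_nhds hr))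

theorem lowerEnvelope_hamiltonian_le
    (hf : Continuous fun z : E × A × B => f z.1 z.2.1 z.2.2)
    (hc : Continuous fun z : E × A × B => c z.1 z.2.1 z.2.2) {s₀ : E} (hs₀ : s₀ ∈ closure Kᶜ)
    (p : E →L[ℝ] ℝ) :
    lowerEnvelope Set.univ
      (fun q : E × (E →L[ℝ] ℝ) => (hamiltonian f c K q.1 q.2 : EReal)) (s₀, p) ≤
        (((⨅ a, ⨆ b, (c s₀ a b + p (f s₀ a b)) : ℝ)) : EReal) := by
  refine le_of_forall_gt_imp_ge_of_dense fun r hr => ?_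
  exact liminf_le_of_frequently_le (frequently_hamiltonian hf hc hs₀ p (Iic_mem_nhds hr))

theorem exists_feedback_zeroOn [Nonempty A] [Nonempty B] [MeasurableSpace A] [BorelSpace A]
    [MeasurableSpace B] (hK : IsClosed K) (hf : Continuous fun z : E × A × B => f z.1 z.2.1 z.2.2)
    (hc : Continuous fun z : E × A × B => c z.1 z.2.1 z.2.2) {s₀ : E} {q : ℝ} (p : E →L[ℝ] ℝ)
    (h₁ : s₀ ∈ K → 0 < q)
    (h₂ : s₀ ∈ closure Kᶜ → 0 < q + ⨅ a, ⨆ b, (c s₀ a b + p (f s₀ a b))) :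
    ∃ ψ : A → B, Measurable ψ ∧ ∃ θ > 0, ∀ᶠ s in 𝓝 s₀, ∀ a,
      θ ≤ q + zeroOn K c s a (ψ a) + p (zeroOn K f s a (ψ a)) := by
  have hG : Continuous fun z : E × A × B => c z.1 z.2.1 z.2.2 + p (f z.1 z.2.1 z.2.2) := by
    fun_prop
  by_cases hcl : s₀ ∈ closure Kᶜ
  · obtain ⟨ψ, hψ, θ, hθ, ha⟩ := exists_feedback_of_lt_iInf_iSup
      (G := fun s a b => c s a b + p (f s a b)) hG (s₀ := s₀) (r := -q)
      (by linarith [h₂ hcl])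
    by_cases hs₀ : s₀ ∈ K
    · refine ⟨ψ, hψ, min θ q, lt_min hθ (h₁ hs₀), ?_⟩
      filter_upwards [ha] with s hs a
      by_cases hsK : s ∈ K
      · rw [zeroOn_of_mem hsK, zeroOn_of_mem hsK, map_zero]
        linarith [min_le_right θ q]
      · rw [zeroOn_of_notMem hsK, zeroOn_of_notMem hsK]
        linarith [min_le_left θ q, hs a]
    · refine ⟨ψ, hψ, θ, hθ, ?_⟩
      filter_upwards [ha, hK.isOpen_compl.mem_nhds hs₀] with s hs hsK a
      rw [zeroOn_of_notMem hsK, zeroOn_of_notMem hsK]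
      linarith [hs a]
  · have hev := eventually_mem_of_notMem_closure_compl hcl
    refine ⟨fun _ => Classical.arbitrary B, measurable_const, q, h₁ hev.self_of_nhds, ?_⟩
    filter_upwards [hev] with s hs a
    rw [zeroOn_of_mem hs, zeroOn_of_mem hs, map_zero]
    linarith

end Hamiltonian

/-! ### Bounds on the value and the viscosity inequalities. -/

section Viscosity

theorem openStrip_subset_strip (E : Type*) (T : ℝ) : openStrip E T ⊆ strip E T :=
  Set.prod_mono_right Set.Ioo_subset_Icc_self

theorem openStrip_mem_nhds {E : Type*} [TopologicalSpace E] {T : ℝ} {z : E × ℝ}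
    (hz : z ∈ openStrip E T) : openStrip E T ∈ 𝓝 z :=
  (isOpen_univ.prod isOpen_Ioo).mem_nhds hz

theorem truncatedValue_nonneg {E A B : Type*} [NormedAddCommGroup E] [NormedSpace ℝ E]
    {K : Set E} [MeasurableSpace A] [MeasurableSpace B] [Nonempty B] {f : E → A → B → E}
    {c : E → A → B → ℝ} {T : ℝ} (hc0 : ∀ s a b, 0 ≤ c s a b) {z : E × ℝ}
    (hz : z.2 ≤ T) : 0 ≤ truncatedValue f c K T z := by
  refine le_truncatedValue (r := 0) (Strategy.const A _ (Classical.arbitrary B)) fun a x _ => ?_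
  refine intervalIntegral.integral_nonneg hz fun τ _ => ?_
  unfold zeroOn
  split_ifs
  · exact le_rfl
  · exact hc0 _ _ _

theorem fderiv_zero_one_eq_deriv {E : Type*} [NormedAddCommGroup E] [NormedSpace ℝ E]
    {φ : E × ℝ → ℝ} {z₀ : E × ℝ} (hφ : DifferentiableAt ℝ φ z₀) :
    fderiv ℝ φ z₀ (0, 1) = deriv (fun t => φ (z₀.1, t)) z₀.2 := by
  have h1 : HasDerivAt (fun t : ℝ => (z₀.1, t)) ((0 : E), (1 : ℝ)) z₀.2 :=
    (hasDerivAt_const _ _).prodMk (hasDerivAt_id _)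
  exact (HasFDerivAt.comp_hasDerivAt z₀.2 (f := fun t : ℝ => (z₀.1, t))
    hφ.hasFDerivAt h1).deriv.symm

variable {E A B : Type*} [NormedAddCommGroup E] [NormedSpace ℝ E] [ProperSpace E]
  [MeasurableSpace E] [BorelSpace E] {K : Set E}
  [MetricSpace A] [CompactSpace A] [Nonempty A] [MeasurableSpace A] [BorelSpace A]
  [MetricSpace B] [CompactSpace B] [MeasurableSpace B] [BorelSpace B]
  {f : E → A → B → E} {c : E → A → B → ℝ} {T : ℝ} {L : NNReal} {M : ℝ}

/-- This single bound yields both local boundedness and continuous attainment of the terminal value.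
-/
theorem eventually_truncatedValue_le (hK : IsClosed K)
    (hf : LipschitzWith L fun z : E × A × B => f z.1 z.2.1 z.2.2) (hM : ∀ s a b, ‖f s a b‖ ≤ M)
    (hM0 : 0 ≤ M) (hc : Continuous fun z : E × A × B => c z.1 z.2.1 z.2.2) (z₀ : E × ℝ) :
    ∃ C : ℝ, 0 ≤ C ∧ ∀ᶠ z in 𝓝[strip E T] z₀,
      truncatedValue f c K T z ≤ ((C * (T - z.2) : ℝ) : EReal) := by
  -- A trajectory that starts within distance `1` of `z₀.1` stays in this ball up to time `T`, so
  -- `c` is bounded along it.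
  have hcomp : IsCompact (Metric.closedBall z₀.1 (1 + M * T) ×ˢ (Set.univ : Set (A × B))) :=
    (isCompact_closedBall _ _).prod isCompact_univ
  obtain ⟨C, hC⟩ := hcomp.exists_bound_of_continuousOn hc.continuousOn
  refine ⟨max C 0, le_max_right _ _, ?_⟩
  filter_upwards [self_mem_nhdsWithin, nhdsWithin_le_nhds (Metric.ball_mem_nhds z₀ one_pos)]
    with z hz hzb
  obtain ⟨s, t⟩ := z
  have ht : t ∈ Set.Icc 0 T := hz.2
  refine truncatedValue_le fun β => ?_
  let a : Control A t := Control.const t (Classical.arbitrary A)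
  obtain ⟨x, hx⟩ := exists_isModifiedTrajectory hK hf hM s a (β.1 a)
  refine ⟨a, x, hx, (le_abs_self _).trans ?_⟩
  rw [← Real.norm_eq_abs]
  refine (intervalIntegral.norm_integral_le_of_norm_le_const (C := max C 0) fun τ hτ => ?_).trans ?_
  · change τ ∈ Set.uIoc t T at hτ
    rw [Set.uIoc_of_le ht.2] at hτ
    refine (norm_zeroOn_le _ _ _ _).trans ((hC (x τ, a.1 τ, (β.1 a).1 τ) ⟨?_, trivial⟩).trans
      (le_max_left _ _))
    rw [Metric.mem_closedBall]
    have h1 : dist s z₀.1 < 1 := by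
      have := Metric.mem_ball.1 hzb
      rw [Prod.dist_eq] at this
      exact (le_max_left _ _).trans_lt this
    have h2 := hx.norm_sub_le hM hτ.1.le
    rw [← dist_eq_norm] at h2
    have h3 : M * (τ - t) ≤ M * T := by
      gcongr
      linarith [hτ.2, ht.1]
    linarith [dist_triangle (x τ) s z₀.1]
  · rw [abs_of_nonneg (sub_nonneg.2 ht.2)]

theorem truncatedValue_eq_zero_of_mem [Nonempty B] (hK : IsClosed K)
    (hf : LipschitzWith L fun z : E × A × B => f z.1 z.2.1 z.2.2) (hM : ∀ s a b, ‖f s a b‖ ≤ M)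
    (hc0 : ∀ s a b, 0 ≤ c s a b) {z : E × ℝ} (hs : z.1 ∈ K) (hz : z.2 ≤ T) :
    truncatedValue f c K T z = 0 := by
  refine le_antisymm (truncatedValue_le (r := 0) fun β => ?_) (truncatedValue_nonneg hc0 hz)
  let a : Control A z.2 := Control.const z.2 (Classical.arbitrary A)
  obtain ⟨x, hx⟩ := exists_isModifiedTrajectory hK hf hM z.1 a (β.1 a)
  refine ⟨a, x, hx, (intervalIntegral.integral_zero_ae (ae_of_all _ fun τ hτ => ?_)).le⟩
  rw [Set.uIoc_of_le hz] at hτ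
  refine zeroOn_of_mem (K := K) ?_ _ _
  rw [hx.frozen z.2 Set.self_mem_Ici (hx.initial.symm ▸ hs) τ hτ.1.le, hx.initial]
  exact hs

theorem truncatedValue_terminal [Nonempty B] (hK : IsClosed K)
    (hf : LipschitzWith L fun z : E × A × B => f z.1 z.2.1 z.2.2) (hM : ∀ s a b, ‖f s a b‖ ≤ M)
    (hc0 : ∀ s a b, 0 ≤ c s a b) (s : E) : truncatedValue f c K T (s, T) = 0 := by
  refine le_antisymm (truncatedValue_le (r := 0) fun β => ?_) (truncatedValue_nonneg hc0 le_rfl)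
  let a : Control A T := Control.const T (Classical.arbitrary A)
  obtain ⟨x, hx⟩ := exists_isModifiedTrajectory hK hf hM s a (β.1 a)
  exact ⟨a, x, hx, by simp⟩

/-- If a test function above the value violates the subsolution inequality at a point, then the
value is bounded near the point by a number smaller than the test function at the point. -/
theorem exists_lt_eventually_truncatedValue_le (hK : IsClosed K)
    (hf : LipschitzWith L fun z : E × A × B => f z.1 z.2.1 z.2.2) (hM : ∀ s a b, ‖f s a b‖ ≤ M)
    (hM0 : 0 ≤ M) (hc : Continuous fun z : E × A × B => c z.1 z.2.1 z.2.2) {z₀ : E × ℝ}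
    (hz₀ : z₀ ∈ openStrip E T) {φ : E × ℝ → ℝ} (hφ : ContDiffOn ℝ 1 φ (openStrip E T))
    (hW : ∀ᶠ z in 𝓝 z₀, truncatedValue f c K T z ≤ (φ z : EReal))
    (h₁ : z₀.1 ∈ K → fderiv ℝ φ z₀ (0, 1) < 0)
    (h₂ : z₀.1 ∈ closure Kᶜ → fderiv ℝ φ z₀ (0, 1) + ⨅ a, ⨆ b, (c z₀.1 a b +
      (fderiv ℝ φ z₀).comp (ContinuousLinearMap.inl ℝ E ℝ) (f z₀.1 a b)) < 0) :
    ∃ r < φ z₀, ∀ᶠ z in 𝓝 z₀, truncatedValue f c K T z ≤ (r : EReal) := by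
  have hcd := hφ.contDiffAt (openStrip_mem_nhds hz₀)
  obtain ⟨a, θ, hθ, ha⟩ := exists_action_zeroOn hK hf.continuous hc
    ((fderiv ℝ φ z₀).comp (ContinuousLinearMap.inl ℝ E ℝ)) h₁ h₂
  obtain ⟨δ, hδ, hev⟩ := truncatedValue_le_sub hK hf hM hM0 hc hz₀
    (hcd.hasStrictFDerivAt one_ne_zero) hW hθ a ha
  refine ⟨φ z₀ - δ / 2, by linarith, ?_⟩
  have hφc : ∀ᶠ z in 𝓝 z₀, φ z ≤ φ z₀ + δ / 2 :=
    hcd.continuousAt.eventually (Iic_mem_nhds (by linarith))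
  filter_upwards [hev, hφc] with z h1 h2
  exact h1.trans (EReal.coe_le_coe_iff.2 (by linarith))

/-- If a test function below the value violates the supersolution inequality at a point, then the
value is bounded below near the point by a number larger than the test function at the point. -/
theorem exists_gt_eventually_le_truncatedValue [Nonempty B] (hK : IsClosed K)
    (hf : LipschitzWith L fun z : E × A × B => f z.1 z.2.1 z.2.2) (hM : ∀ s a b, ‖f s a b‖ ≤ M)
    (hM0 : 0 ≤ M) (hc : Continuous fun z : E × A × B => c z.1 z.2.1 z.2.2) {z₀ : E × ℝ}
    (hz₀ : z₀ ∈ openStrip E T) {φ : E × ℝ → ℝ} (hφ : ContDiffOn ℝ 1 φ (openStrip E T))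
    (hW : ∀ᶠ z in 𝓝 z₀, (φ z : EReal) ≤ truncatedValue f c K T z)
    (h₁ : z₀.1 ∈ K → 0 < fderiv ℝ φ z₀ (0, 1))
    (h₂ : z₀.1 ∈ closure Kᶜ → 0 < fderiv ℝ φ z₀ (0, 1) + ⨅ a, ⨆ b, (c z₀.1 a b +
      (fderiv ℝ φ z₀).comp (ContinuousLinearMap.inl ℝ E ℝ) (f z₀.1 a b))) :
    ∃ r > φ z₀, ∀ᶠ z in 𝓝 z₀, (r : EReal) ≤ truncatedValue f c K T z := by
  have hcd := hφ.contDiffAt (openStrip_mem_nhds hz₀)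
  obtain ⟨ψ, hψ, θ, hθ, ha⟩ := exists_feedback_zeroOn hK hf.continuous hc
    ((fderiv ℝ φ z₀).comp (ContinuousLinearMap.inl ℝ E ℝ)) h₁ h₂
  obtain ⟨δ, hδ, hev⟩ := add_le_truncatedValue hK hf hM hM0 hc hz₀
    (hcd.hasStrictFDerivAt one_ne_zero) hW hθ hψ ha
  refine ⟨φ z₀ + δ / 2, by linarith, ?_⟩
  have hφc : ∀ᶠ z in 𝓝 z₀, φ z₀ - δ / 2 ≤ φ z :=
    hcd.continuousAt.eventually (Ici_mem_nhds (by linarith))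
  filter_upwards [hev, hφc] with z h1 h2
  exact (EReal.coe_le_coe_iff.2 (by linarith)).trans h1

theorem subsolutionTest_upperEnvelope [Nonempty B] (hK : IsClosed K)
    (hf : LipschitzWith L fun z : E × A × B => f z.1 z.2.1 z.2.2) (hM : ∀ s a b, ‖f s a b‖ ≤ M)
    (hM0 : 0 ≤ M) (hc : Continuous fun z : E × A × B => c z.1 z.2.1 z.2.2) :
    SubsolutionTest T
      (fun s p => upperEnvelope Set.univ
        (fun q : E × (E →L[ℝ] ℝ) => (hamiltonian f c K q.1 q.2 : EReal)) (s, p))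
      (upperEnvelope (strip E T) (truncatedValue f c K T)) := by
  intro φ hφ z₀ hz₀ heq hle
  by_contra hneg
  rw [not_le] at hneg
  -- The envelope could a priori be infinite, so it is only compared with real numbers: `0` when
  -- `z₀.1 ∈ K`, and the unmodified Hamiltonian when `z₀.1 ∈ closure Kᶜ`.
  have hlt : ∀ v : ℝ, (v : EReal) ≤ upperEnvelope Set.univ
      (fun q : E × (E →L[ℝ] ℝ) => (hamiltonian f c K q.1 q.2 : EReal))
      (z₀.1, (fderiv ℝ φ z₀).comp (ContinuousLinearMap.inl ℝ E ℝ)) →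
      fderiv ℝ φ z₀ (0, 1) + v < 0 := fun v hv => by
    have := (add_le_add_right hv ((fderiv ℝ φ z₀ (0, 1) : ℝ) : EReal)).trans_lt hneg
    rw [← EReal.coe_add] at this
    exact EReal.coe_lt_coe_iff.1 this
  have hW : ∀ᶠ z in 𝓝 z₀, truncatedValue f c K T z ≤ (φ z : EReal) := by
    filter_upwards [hle, openStrip_mem_nhds hz₀] with z h1 h2
    exact (le_upperEnvelope (openStrip_subset_strip E T h2)).trans h1
  have hmem : z₀.1 ∈ K → fderiv ℝ φ z₀ (0, 1) < 0 := fun hs => by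
    have := hlt _ (hamiltonian_le_upperEnvelope _ _)
    rwa [hamiltonian_of_mem hs, add_zero] at this
  obtain ⟨r, hr, hev⟩ := exists_lt_eventually_truncatedValue_le hK hf hM hM0 hc hz₀ hφ hW hmem
    fun hs => hlt _ (le_upperEnvelope_hamiltonian hf.continuous hc hs _)
  -- A bound `r < φ z₀` on a full neighbourhood passes to the envelope, which contradicts contact at
  -- `z₀`.
  have := upperEnvelope_le (D := strip E T) (nhdsWithin_le_nhds hev)
  rw [heq, EReal.coe_le_coe_iff] at this
  exact absurd this (not_le.2 hr)

theorem supersolutionTest_lowerEnvelope [Nonempty B] (hK : IsClosed K)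
    (hf : LipschitzWith L fun z : E × A × B => f z.1 z.2.1 z.2.2) (hM : ∀ s a b, ‖f s a b‖ ≤ M)
    (hM0 : 0 ≤ M) (hc : Continuous fun z : E × A × B => c z.1 z.2.1 z.2.2) :
    SupersolutionTest T
      (fun s p => lowerEnvelope Set.univ
        (fun q : E × (E →L[ℝ] ℝ) => (hamiltonian f c K q.1 q.2 : EReal)) (s, p))
      (lowerEnvelope (strip E T) (truncatedValue f c K T)) := by
  intro φ hφ z₀ hz₀ heq hle
  by_contra hneg
  rw [not_le] at hneg
  have hlt : ∀ v : ℝ, lowerEnvelope Set.univ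
      (fun q : E × (E →L[ℝ] ℝ) => (hamiltonian f c K q.1 q.2 : EReal))
      (z₀.1, (fderiv ℝ φ z₀).comp (ContinuousLinearMap.inl ℝ E ℝ)) ≤ (v : EReal) →
      0 < fderiv ℝ φ z₀ (0, 1) + v := fun v hv => by
    have := hneg.trans_le (add_le_add_right hv ((fderiv ℝ φ z₀ (0, 1) : ℝ) : EReal))
    rw [← EReal.coe_add] at this
    exact EReal.coe_lt_coe_iff.1 this
  have hW : ∀ᶠ z in 𝓝 z₀, (φ z : EReal) ≤ truncatedValue f c K T z := by
    filter_upwards [hle, openStrip_mem_nhds hz₀] with z h1 h2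
    exact h1.trans (lowerEnvelope_le (openStrip_subset_strip E T h2))
  have hmem : z₀.1 ∈ K → 0 < fderiv ℝ φ z₀ (0, 1) := fun hs => by
    have := hlt _ (lowerEnvelope_le_hamiltonian _ _)
    rwa [hamiltonian_of_mem hs, add_zero] at this
  obtain ⟨r, hr, hev⟩ := exists_gt_eventually_le_truncatedValue hK hf hM hM0 hc hz₀ hφ hW hmem
    fun hs => hlt _ (lowerEnvelope_hamiltonian_le hf.continuous hc hs _)
  have := le_lowerEnvelope (D := strip E T) (nhdsWithin_le_nhds hev)
  rw [heq, EReal.coe_le_coe_iff] at this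
  exact absurd this (not_le.2 hr)

theorem isViscositySolution_truncatedValue [Nonempty B] (hK : IsClosed K)
    (hf : LipschitzWith L fun z : E × A × B => f z.1 z.2.1 z.2.2) (hM : ∀ s a b, ‖f s a b‖ ≤ M)
    (hc : Continuous fun z : E × A × B => c z.1 z.2.1 z.2.2) (hc0 : ∀ s a b, 0 ≤ c s a b)
    (hT : 0 ≤ T) :
    IsViscositySolution T (hamiltonian f c K) (fun _ => 0) (truncatedValue f c K T) := by
  have hM0 : 0 ≤ M :=
    (norm_nonneg _).trans (hM 0 (Classical.arbitrary A) (Classical.arbitrary B))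
  have hnonneg : ∀ z, ∀ᶠ y in 𝓝[strip E T] z, 0 ≤ truncatedValue f c K T y := fun z => by
    filter_upwards [self_mem_nhdsWithin] with y hy using truncatedValue_nonneg hc0 hy.2.2
  have hterm := truncatedValue_terminal (T := T) hK hf hM hc0
  have hvert : ∀ {z₀ : E × ℝ}, z₀ ∈ openStrip E T → z₀.1 ∈ K →
      ∀ᶠ t in 𝓝 z₀.2, truncatedValue f c K T (z₀.1, t) = 0 := fun {z₀} hz₀ hs => by
    filter_upwards [Iic_mem_nhds hz₀.2.2] with t ht
    exact truncatedValue_eq_zero_of_mem hK hf hM hc0 hs ht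
  have hline : ∀ z₀ : E × ℝ, Tendsto (fun t : ℝ => (z₀.1, t)) (𝓝 z₀.2) (𝓝 z₀) := fun z₀ =>
    (Continuous.prodMk_right z₀.1).tendsto z₀.2
  refine ⟨fun z hz => ⟨?_, ?_⟩, ?_, ?_, ?_, ?_, hterm, fun s => ⟨?_, ?_⟩⟩
  · obtain ⟨C, hC, hev⟩ := eventually_truncatedValue_le (T := T) hK hf hM hM0 hc z
    refine (upperEnvelope_le (r := ((C * T : ℝ) : EReal)) ?_).trans_lt (EReal.coe_lt_top _)
    filter_upwards [hev, self_mem_nhdsWithin] with y hy hyS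
    refine hy.trans (EReal.coe_le_coe_iff.2 ?_)
    gcongr
    linarith [hyS.2.1]
  · exact EReal.bot_lt_zero.trans_le (le_lowerEnvelope (hnonneg z))
  · exact subsolutionTest_upperEnvelope hK hf hM hM0 hc
  · exact supersolutionTest_lowerEnvelope hK hf hM hM0 hc
  · intro φ hφ z₀ hz₀ heq hle
    have hcd := hφ.contDiffAt (openStrip_mem_nhds hz₀)
    by_cases hs : z₀.1 ∈ K
    -- The value vanishes on the vertical line through a point of `K`, so `φ` restricted to that
    -- line is nonnegative and touches zero.
    · have hd : deriv (fun t => φ (z₀.1, t)) z₀.2 = 0 := by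
        refine IsLocalMin.deriv_eq_zero ?_
        filter_upwards [(hline z₀).eventually hle, hvert hz₀ hs] with t h1 h2
        rw [h2] at h1
        rw [(hvert hz₀ hs).self_of_nhds] at heq
        have h3 : φ z₀ = 0 := by exact_mod_cast heq.symm
        exact h3.le.trans (by exact_mod_cast h1)
      beta_reduce
      rw [hamiltonian_of_mem hs, fderiv_zero_one_eq_deriv (hcd.differentiableAt one_ne_zero), hd]
      simp
    · by_contra! hneg
      rw [hamiltonian_of_notMem hs, ← EReal.coe_add] at hneg
      obtain ⟨r, hr, hev⟩ := exists_lt_eventually_truncatedValue_le hK hf hM hM0 hc hz₀ hφ hle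
        (fun h => absurd h hs) (fun _ => by exact_mod_cast hneg)
      have := hev.self_of_nhds
      rw [heq, EReal.coe_le_coe_iff] at this
      exact absurd this (not_le.2 hr)
  · intro φ hφ z₀ hz₀ heq hle
    have hcd := hφ.contDiffAt (openStrip_mem_nhds hz₀)
    by_cases hs : z₀.1 ∈ K
    · have hd : deriv (fun t => φ (z₀.1, t)) z₀.2 = 0 := by
        refine IsLocalMax.deriv_eq_zero ?_
        filter_upwards [(hline z₀).eventually hle, hvert hz₀ hs] with t h1 h2
        rw [h2] at h1
        rw [(hvert hz₀ hs).self_of_nhds] at heq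
        have h3 : φ z₀ = 0 := by exact_mod_cast heq.symm
        exact (show φ (z₀.1, t) ≤ 0 by exact_mod_cast h1).trans h3.ge
      beta_reduce
      rw [hamiltonian_of_mem hs, fderiv_zero_one_eq_deriv (hcd.differentiableAt one_ne_zero), hd]
      simp
    · by_contra! hneg
      rw [hamiltonian_of_notMem hs, ← EReal.coe_add] at hneg
      obtain ⟨r, hr, hev⟩ := exists_gt_eventually_le_truncatedValue hK hf hM hM0 hc hz₀ hφ hle
        (fun h => absurd h hs) (fun _ => by exact_mod_cast hneg)
      have := hev.self_of_nhds
      rw [heq, EReal.coe_le_coe_iff] at this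
      exact absurd this (not_le.2 hr)
  · have hmem : (s, T) ∈ strip E T := ⟨trivial, hT, le_rfl⟩
    refine le_antisymm ?_ ((hterm s).ge.trans (le_upperEnvelope hmem))
    obtain ⟨C, hC, hev⟩ := eventually_truncatedValue_le (T := T) hK hf hM hM0 hc (s, T)
    -- Nontriviality of the filter identifies the upper limit of `C(T - t)` with its limit `0`.
    have hne : (𝓝[strip E T] (s, T)).NeBot := mem_closure_iff_nhdsWithin_neBot.1
      (subset_closure hmem)
    have hlim : Tendsto (fun z : E × ℝ => ((C * (T - z.2) : ℝ) : EReal)) (𝓝[strip E T] (s, T))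
        (𝓝 ((0 : ℝ) : EReal)) := by
      have h1 : Continuous fun z : E × ℝ => ((C * (T - z.2) : ℝ) : EReal) :=
        continuous_coe_real_ereal.comp (by fun_prop)
      have h2 := h1.tendsto (s, T)
      simp only [sub_self, mul_zero] at h2
      exact h2.mono_left nhdsWithin_le_nhds
    exact (limsup_le_limsup hev).trans hlim.limsup_eq.le
  · have hmem : (s, T) ∈ strip E T := ⟨trivial, hT, le_rfl⟩
    exact le_antisymm ((lowerEnvelope_le hmem).trans (hterm s).le)
      (le_lowerEnvelope (hnonneg _))

end Viscosity

theorem theorem4 (n : ℕ) {A B : Type*}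
    [MetricSpace A] [CompactSpace A] [Nonempty A] [MeasurableSpace A] [BorelSpace A]
    [MetricSpace B] [CompactSpace B] [Nonempty B] [MeasurableSpace B] [BorelSpace B]
    (f : EuclideanSpace ℝ (Fin n) → A → B → EuclideanSpace ℝ (Fin n))
    (hf_lip : ∃ L : NNReal, LipschitzWith L
      (fun z : EuclideanSpace ℝ (Fin n) × A × B => f z.1 z.2.1 z.2.2))
    (hf_bdd : ∃ M : ℝ, ∀ s a b, ‖f s a b‖ ≤ M)
    (c : EuclideanSpace ℝ (Fin n) → A → B → ℝ)
    (hc_cont : Continuous (fun z : EuclideanSpace ℝ (Fin n) × A × B => c z.1 z.2.1 z.2.2))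
    (γ : ℝ) (hγ : 0 < γ)
    (hc_min : IsLeast
      (Set.range (fun z : EuclideanSpace ℝ (Fin n) × A × B => c z.1 z.2.1 z.2.2)) γ)
    (K : Set (EuclideanSpace ℝ (Fin n))) (hK : IsClosed K)
    (T : ℝ) (hT : 0 ≤ T) :
    IsViscositySolution T (hamiltonian f c K) (fun _ => 0) (truncatedValue f c K T) := by
  obtain ⟨L, hf⟩ := hf_lip
  obtain ⟨M, hM⟩ := hf_bdd
  exact isViscositySolution_truncatedValue hK hf hM hc_cont
    (fun s a b => hγ.le.trans (hc_min.2 ⟨(s, a, b), rfl⟩)) hT
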